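/- Let $G=(V,E)$ be a finite connected simple graph. **Node game.** A search schedule is a finite list of moves; a move places a new searcher on a node, removes a searcher from a node, or slides a searcher from a node along an edge. At time $0$ there are no searchers and all nodes are dirty. After each move, a node is dirty iff it is joined, by a path with no searcher on any of its nodes (end nodes included), to a node that was dirty before the move; all other nodes are clear. Recontamination means that a clear node becomes dirty. Let $\overline{sn}(S)$ be the maximum over time of the number of searchers in the graph. A *rooted IMC node-clearing search* with root $x$ is a schedule $S$ in which searchers are placed only on $x$ and never removed, the set of clear nodes never loses a node, the subgraph induced by the clear nodes is connected at all times $t\ge 1$, and all nodes are clear at the end. It is *minimal* if $\overline{sn}(S)\le\overline{sn}(S')$ for all rooted IMC node-clearing searches $S'$ of $G$ (with any root). **Uniform GSST with $M$ iterations.** Each iteration is independent of the others and does the following. 1. Generate a spanning tree $T$ of $G$ by Wilson's algorithm: start with the tree consisting of a single node $r$; for each node of $G$ in some order, run simple random walk on $G$ from that node until it hits the current tree, erase its loops in chronological order, and add the resulting path to the tree. 2. Choose a root $u_0\in V$ uniformly at random and begin the schedule $S$ by placing a searcher on $u_0$. 3. While dirty nodes remain, select a random edge $uv$ of $T$ with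 $u$ clear and $v$ dirty. If some searcher can reach $u$ inside the clear graph and then slide from $u$ to $v$, all without recontamination, append such moves of one searcher to $S$; otherwise append the placement of a new searcher on $u_0$. In GSST-R, the edge in step 3 is selected uniformly among all edges $uv$ of $T$ with $u$ clear and $v$ dirty. In GSST-LW, it is selected among the same edges with probability proportional to $1/\lambda(uv)$. Here, in the tree $T$ rooted at $u_0$, the label $\lambda(uv)$ of the edge from $u$ to its child $v$ is defined recursively: it is $1$ if $v$ has no children; if $v$ has children, and $\lambda_1\ge\lambda_2\ge\dots$ are the labels of the edges from $v$ to them, it is $\lambda_1$ if there is one child and $\max(\lambda_1,\lambda_2+1)$ otherwise. The output after $M$ iterations is the schedule $S$ with the smallest $\overline{sn}(S)$ among those generated (the first such one). **Theorem.** 1. There is $\alpha_1\in(0,1)$, depending only on $G$, such that for every $M$ uniform GSST-R with $M$ iterations terminates and outputs a minimal rooted IMC node-clearing search of $G$ with probability at least $1-\alpha_1^M$. 2. There is $\alpha_2\in(0,1)$, depending only on $G$, such that for every $M$ uniform GSST-LW with $M$ iterations terminates and outputs a minimal rooted IMC node-clearing search of $G$ with probability at least $1-\alpha_2^M$. Both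 hold whatever the starting node $r$ and the order of the nodes in Wilson's algorithm, whatever the (possibly randomized) rule that chooses the searcher and its way to $u$ in step 3, and both if, after the placement of a new searcher, a new edge is selected and if the edge selected before is kept. -/

import Mathlib

open scoped ENNReal

noncomputable section

namespace GSST

variable {V : Type*}

/-! ## The node game -/

/-- A move: place a new searcher (`0 → v`), remove a searcher (`u → 0`), or slide a searcher
(`u → v`). -/
inductive Move (V : Type*) where
  | place (v : V)
  | remove (u : V)
  | slide (u v : V)

/-- Configuration of the node game: the number of searchers at every node and the n-dirty nodes. -/
structure Config (V : Type*) where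
  searchers : V → ℕ
  dirty : Set V

namespace Config

/-- The n-clear nodes. -/
def clear (c : Config V) : Set V := c.dirtyᶜ

/-- At time 0 there are no searchers and all nodes are n-dirty. -/
def initial : Config V := ⟨fun _ => 0, Set.univ⟩

end Config

open Classical in
/-- Searcher counts after a move. -/
def moveSearchers (k : V → ℕ) : Move V → V → ℕ
  | .place v, w => if w = v then k w + 1 else k w
  | .remove u, w => if w = u then k w - 1 else k w
  | .slide u v, w => if w = u then k w - 1 else if w = v then k w + 1 else k w

/-- A slide goes along an edge; only searchers that are present can slide or be removed. -/
def Legal (G : SimpleGraph V) (c : Config V) : Move V → Prop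
  | .place _ => True
  | .remove u => 0 < c.searchers u
  | .slide u v => 0 < c.searchers u ∧ G.Adj u v

/-- One move of the node game. With `k` the new searcher counts, a node is n-dirty after the move
iff it is joined by a path without any searcher on it (end nodes included) to a node that was
n-dirty before the move. The one-node path covers an n-dirty node that is not being occupied. -/
def step (G : SimpleGraph V) (c : Config V) (m : Move V) : Config V where
  searchers := moveSearchers c.searchers m
  dirty := {x | ∃ y ∈ c.dirty, ∃ p : G.Walk x y, p.IsPath ∧
    ∀ w ∈ p.support, moveSearchers c.searchers m w = 0}

/-- The configuration after a whole list of moves. -/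
def run (G : SimpleGraph V) (S : List (Move V)) : Config V :=
  S.foldl (step G) Config.initial

/-- The configuration at time `t`, i.e. after the first `t` moves. -/
def configAt (G : SimpleGraph V) (S : List (Move V)) (t : ℕ) : Config V :=
  run G (S.take t)

/-- `S` is a search schedule on `G`: every move is legal when it is made. -/
def IsSchedule (G : SimpleGraph V) (S : List (Move V)) : Prop :=
  ∀ (t : ℕ) (m : Move V), S[t]? = some m → Legal G (configAt G S t) m

/-- Searchers are placed only into the root `x`. -/
def IsRooted (x : V) (S : List (Move V)) : Prop :=
  ∀ v, Move.place v ∈ S → v = x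

/-- Searchers, once placed, are never removed (and hence only slide along edges). -/
def IsInternal (S : List (Move V)) : Prop :=
  ∀ u, Move.remove u ∉ S

def IsMonotone (G : SimpleGraph V) (S : List (Move V)) : Prop :=
  ∀ t : ℕ, (configAt G S t).clear ⊆ (configAt G S (t + 1)).clear

/-- The n-clear graph (n-clear nodes and all edges between them) is connected at times
`1, 2, …`. -/
def IsConnected (G : SimpleGraph V) (S : List (Move V)) : Prop :=
  ∀ t : ℕ, 1 ≤ t → t ≤ S.length → (G.induce (configAt G S t).clear).Connected

/-- All nodes are n-clear at the end. -/
def IsNodeClearing (G : SimpleGraph V) (S : List (Move V)) : Prop :=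
  (run G S).clear = Set.univ

/-- `S` is an internal, monotone, connected node clearing search of `G` rooted at `x`. -/
structure IsIMCClearing (G : SimpleGraph V) (x : V) (S : List (Move V)) : Prop where
  schedule : IsSchedule G S
  rooted : IsRooted x S
  internal : IsInternal S
  monotone : IsMonotone G S
  connected : IsConnected G S
  clearing : IsNodeClearing G S

/-- The number of searchers in the graph at time `t`. -/
def sn [Fintype V] (G : SimpleGraph V) (S : List (Move V)) (t : ℕ) : ℕ :=
  ∑ v, (configAt G S t).searchers v

/-- The maximum over time of the number of searchers in the graph. -/
def snMax [Fintype V] (G : SimpleGraph V) (S : List (Move V)) : ℕ :=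
  (Finset.range (S.length + 1)).sup (sn G S)

/-- `S` is a minimal rooted IMC node clearing search of `G`: it is one (for some root), and it uses
the least number of searchers among all of them (for all roots). -/
def IsMinimalRootedIMC [Fintype V] (G : SimpleGraph V) (S : List (Move V)) : Prop :=
  (∃ x, IsIMCClearing G x S) ∧
    IsLeast {k : ℕ | ∃ x S', IsIMCClearing G x S' ∧ snMax G S' = k} (snMax G S)

/-! ## Randomized computations

A while loop gets a bound on its number of passes, the time limit; `none` means that some
loop has not ended within the time limit. -/

/-- Sequential composition. -/
def andThen {α β : Type*} (p : PMF (Option α)) (f : α → PMF (Option β)) : PMF (Option β) :=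
  p.bind fun o => match o with
    | none => PMF.pure none
    | some a => f a

/-! ## Uniform tree generation: Wilson's algorithm -/

open Classical in
/-- Extend a path (listed from its current end back to its start) by `w`, erasing the loop that
this may close. -/
def extendErase (w : V) (path : List V) : List V :=
  if w ∈ path then path.dropWhile (fun x => decide (x ≠ w)) else w :: path

open Classical in
/-- Loop-erased simple random walk on `G`, stopped on reaching the set `A`. The list is the
loop-erased path so far, from the current node back to the starting node. -/
def loopErasedWalk [Fintype V] (G : SimpleGraph V) (A : Set V) :
    ℕ → List V → PMF (Option (List V))
  | _, [] => PMF.pure none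
  | 0, u :: l => if u ∈ A then PMF.pure (some (u :: l)) else PMF.pure none
  | n + 1, u :: l =>
    if u ∈ A then PMF.pure (some (u :: l))
    else if h : (Finset.univ.filter fun w => G.Adj u w).Nonempty then
      (PMF.uniformOfFinset _ h).bind fun w => loopErasedWalk G A n (extendErase w (u :: l))
    else PMF.pure none

/-- The graph formed by the edges between consecutive nodes of a list. -/
def pathEdges : List V → SimpleGraph V
  | [] => ⊥
  | [_] => ⊥
  | a :: b :: l => SimpleGraph.edge a b ⊔ pathEdges (b :: l)

/-- The main loop of Wilson's algorithm: for each listed node in turn, run a loop-erased walk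
from it to the set `A` of nodes of the current tree `T`, and add the resulting path to the tree. -/
def wilsonLoop [Fintype V] (G : SimpleGraph V) (limit : ℕ) :
    List V → Set V → SimpleGraph V → PMF (Option (SimpleGraph V))
  | [], _, T => PMF.pure (some T)
  | i :: order, A, T =>
    andThen (loopErasedWalk G A limit [i]) fun path =>
      wilsonLoop G limit order (A ∪ {x | x ∈ path}) (T ⊔ pathEdges path)

/-- Wilson's algorithm, growing the tree from `r` and treating the nodes in the given order. -/
def wilson [Fintype V] (G : SimpleGraph V) (r : V) (order : List V) (limit : ℕ) :
    PMF (Option (SimpleGraph V)) :=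
  wilsonLoop G limit order {r} ⊥

/-! ## Labels -/

open Classical in
/-- The children of `y` in the tree `T` rooted at `u₀`. -/
def children [Fintype V] (T : SimpleGraph V) (u₀ y : V) : Finset V :=
  Finset.univ.filter fun z => T.Adj y z ∧ T.dist u₀ z = T.dist u₀ y + 1

theorem children_depth [Fintype V] {T : SimpleGraph V} {u₀ y z : V}
    (hz : z ∈ children T u₀ y) :
    Fintype.card V - T.dist u₀ z < Fintype.card V - T.dist u₀ y := by
  have h : T.dist u₀ z = T.dist u₀ y + 1 := by
    simp only [children, Finset.mem_filter] at hz
    exact hz.2.2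
  have hr : T.Reachable u₀ z := SimpleGraph.Reachable.of_dist_ne_zero (by omega)
  obtain ⟨p, hp, hl⟩ := hr.exists_path_of_dist
  have := hp.length_lt
  omega

/-- The label of the edge from `y` to its parent, in the tree `T` rooted at `u₀`: it is 1 if `y` has
no children; otherwise, with the labels `λ₁ ≥ λ₂ ≥ …` of the edges from `y` to its children, it is
`λ₁` if there is one child and `max λ₁ (λ₂ + 1)` if there are more. -/
def rLabel [Fintype V] (T : SimpleGraph V) (u₀ y : V) : ℕ+ :=
  match ((children T u₀ y).attach.toList.map fun z => rLabel T u₀ z.1).mergeSort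
      (fun a b => decide (b ≤ a)) with
  | [] => 1
  | [a] => a
  | a :: b :: _ => max a (b + 1)
termination_by Fintype.card V - T.dist u₀ y
decreasing_by exact children_depth z.2

/-! ## Selection of edges -/

open Classical in
/-- The n-dirty edges `uv` of `T` adjacent to the n-clear graph, written as pairs `(u, v)` with `u`
n-clear and `v` n-dirty. -/
def candidates [Fintype V] (T : SimpleGraph V) (c : Config V) : Finset (V × V) :=
  Finset.univ.filter fun e => T.Adj e.1 e.2 ∧ e.1 ∈ c.clear ∧ e.2 ∈ c.dirty

/-- The selection rules: Randomized, and Labeled Weighted. -/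
inductive Rule where
  | R
  | LW

/-- A random element of `s`, with probability inversely proportional to its label. -/
def inverselyProportional {α : Type*} (s : Finset α) (hs : s.Nonempty) (label : α → ℕ+) :
    PMF α :=
  PMF.normalize ((s : Set α).indicator fun a => ((label a : ℕ) : ℝ≥0∞)⁻¹)
    (by
      obtain ⟨a, ha⟩ := hs
      intro h
      have := ENNReal.tsum_eq_zero.1 h a
      simp [ha] at this)
    (by
      rw [tsum_eq_sum (s := s) (fun a ha => by simp [ha])]
      refine ENNReal.sum_ne_top.2 fun a ha => ?_
      simp [ha])

/-- The next edge to be traversed, for the tree `T` rooted at `u₀`. -/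
def selectEdge [Fintype V] (rule : Rule) (T : SimpleGraph V) (u₀ : V) (s : Finset (V × V))
    (hs : s.Nonempty) : PMF (V × V) :=
  match rule with
  | .R => PMF.uniformOfFinset s hs
  | .LW => inverselyProportional s hs fun e => rLabel T u₀ e.2

/-! ## GSST -/

/-- The moves of one searcher who visits the listed nodes in turn. -/
def slides : List V → List (Move V)
  | [] => []
  | [_] => []
  | a :: b :: l => Move.slide a b :: slides (b :: l)

/-- After the moves `S`, a searcher can go along the nodes listed in `p`, inside the n-clear graph,
to `u`, and then traverse `uv`, all without recontamination. -/
structure Traversal (G : SimpleGraph V) (S : List (Move V)) (u v : V) (p : List V) : Prop where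
  ends : p.getLast? = some u
  inside : ∀ w ∈ p, w ∈ (run G S).clear
  schedule : IsSchedule G (S ++ slides (p ++ [v]))
  noRecontamination : ∀ t, S.length ≤ t →
    (configAt G (S ++ slides (p ++ [v])) t).clear ⊆
      (configAt G (S ++ slides (p ++ [v])) (t + 1)).clear

/-- A (possibly randomized) way of choosing, for the tree, the root, the moves so far and the
endpoints of the selected edge, the searcher who traverses this edge and his way there. -/
abbrev Mover (V : Type*) := SimpleGraph V → V → List (Move V) → V → V → PMF (List V)

/-- Whenever some searcher can traverse the edge without recontamination, the mover makes a searcher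
do so. -/
def IsMover (G : SimpleGraph V) (mover : Mover V) : Prop :=
  ∀ T u₀ S u v, (∃ p, Traversal G S u v p) →
    ∀ p ∈ (mover T u₀ S u v).support, Traversal G S u v p

open Classical in
/-- The while loop of GSST, on the tree `T` rooted at `u₀`. In each pass an edge is selected; if a
searcher can traverse it without recontamination, this is done, and otherwise a new searcher is
placed into the root. After such a placement, the next pass selects an edge anew if `keep` is
`false`, and keeps to the same edge if `keep` is `true`; `target` is the edge kept, if any. -/
def searchLoop [Fintype V] (G : SimpleGraph V) (rule : Rule) (keep : Bool) (mover : Mover V)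
    (T : SimpleGraph V) (u₀ : V) :
    ℕ → Option (V × V) → List (Move V) → PMF (Option (List (Move V)))
  | 0, _, S => if (run G S).dirty = ∅ then PMF.pure (some S) else PMF.pure none
  | n + 1, target, S =>
    if (run G S).dirty = ∅ then PMF.pure (some S)
    else if h : (candidates T (run G S)).Nonempty then
      (match target with
        | some e => PMF.pure e
        | none => selectEdge rule T u₀ _ h).bind fun e =>
          if ∃ p, Traversal G S e.1 e.2 p then
            (mover T u₀ S e.1 e.2).bind fun p =>
              searchLoop G rule keep mover T u₀ n none (S ++ slides (p ++ [e.2]))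
          else
            searchLoop G rule keep mover T u₀ n (if keep then some e else none)
              (S ++ [Move.place u₀])
    else PMF.pure none

/-- One iteration of uniform GSST: generate a spanning tree by Wilson's algorithm, choose a root
uniformly at random, place a searcher into it, and run the while loop. -/
def iteration [Fintype V] [Nonempty V] (G : SimpleGraph V) (rule : Rule) (keep : Bool)
    (r : V) (order : List V) (mover : Mover V) (limit : ℕ) : PMF (Option (List (Move V))) :=
  andThen (wilson G r order limit) fun T =>
    (PMF.uniformOfFintype V).bind fun u₀ =>
      searchLoop G rule keep mover T u₀ limit none [Move.place u₀]

/-- The for loop of GSST, with the best schedule so far and its number of searchers. -/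
def gsstLoop [Fintype V] [Nonempty V] (G : SimpleGraph V) (rule : Rule) (keep : Bool)
    (r : V) (order : List V) (mover : Mover V) (limit : ℕ) :
    ℕ → List (Move V) → ℕ∞ → PMF (Option (List (Move V)))
  | 0, Smin, _ => PMF.pure (some Smin)
  | m + 1, Smin, smin =>
    andThen (iteration G rule keep r order mover limit) fun S =>
      if (snMax G S : ℕ∞) < smin then
        gsstLoop G rule keep r order mover limit m S (snMax G S)
      else
        gsstLoop G rule keep r order mover limit m Smin smin

/-- Uniform GSST with `M` iterations. -/
def gsst [Fintype V] [Nonempty V] (G : SimpleGraph V) (rule : Rule) (keep : Bool)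
    (r : V) (order : List V) (mover : Mover V) (M limit : ℕ) : PMF (Option (List (Move V))) :=
  gsstLoop G rule keep r order mover limit M [] ⊤

/-- The probability that uniform GSST with `M` iterations (without a time limit) ends and outputs a
minimal rooted IMC node clearing search of `G`. A run that ends within a time limit is the same
under any larger limit, so this is the limit, and the supremum, of the probabilities under finite
time limits. -/
def successProb [Fintype V] [Nonempty V] (G : SimpleGraph V) (rule : Rule) (keep : Bool)
    (r : V) (order : List V) (mover : Mover V) (M : ℕ) : ℝ≥0∞ :=
  ⨆ limit : ℕ, (gsst G rule keep r order mover M limit).toOuterMeasure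
    {o | ∃ S, o = some S ∧ IsMinimalRootedIMC G S}

end GSST

end

/-!
In one iteration of uniform GSST everything that is chosen at random has finitely many outcomes,
apart from the random walks and the way of the searchers, and a minimal search results with a
probability bounded away from 0, whatever this way is. The iterations are independent, so that all
of them miss a minimal search with exponentially small probability.

**The output is always a rooted IMC clearing search.** A clear node with a dirty neighbour always
holds a searcher (`Guarded`), so that a slide recontaminates nothing unless it takes the last
searcher from a node with a dirty neighbour other than the target. A searcher that is not needed
where it stands can therefore walk anywhere in the connected clear graph and clear any neighbouring
node (`IsPartial.exists_traversal_of_spare`). In particular a searcher just placed on the root can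
do so, and hence the while loop ends after at most two passes for each dirty node
(`searchLoop_support`).

**A minimal search can be imitated.** The edges `uv` along which a minimal search clears new nodes
form a spanning tree, which is rooted at the root of the search (`IsIMCClearing.exists_tree`). Let
`C` be the set of clear nodes just before `v` is cleared from `u`. The search needs a searcher on
each boundary node of `C`, and a second one on `u` if `u` keeps another dirty neighbour: this is the
number `cost` (`cost_le_sum_searchers`). GSST on this tree, if it selects the same edges in the same
order, has the same clear sets. It places a new searcher only when nobody can traverse `uv`, and
then its searchers stand singly on boundary nodes of `C` and `u` keeps another dirty neighbour, so
that they are fewer than `cost` (`IsPartial.sum_searchers_lt_cost`). Hence it never has more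
searchers than the minimal search, whichever way they move (`Completable.searchLoop_prob`).

**Wilson's algorithm** ends with probability 1, because from everywhere the walk reaches the current
tree within `n` steps with probability at least `n⁻ⁿ` (`loopErasedWalk_none_le`). It generates
a given spanning tree `T₀` with a probability bounded below: with probability at least `n⁻ⁿ` a walk
keeps to `T₀` until it hits the current tree, and no more than `n` walks are not trivial
(`wilsonLoop_isTree_prob`). Uniformity of the generated tree is not needed.

The time limit enters only through the probability that Wilson's algorithm has not ended, which
vanishes in the limit (`one_le_successProb_add`).
-/

noncomputable section

namespace GSST

variable {V : Type*}

/-! ### Probabilities of composed random computations -/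

section Probability

variable {α β : Type*}

theorem toOuterMeasure_add_compl (p : PMF α) (s : Set α) :
    p.toOuterMeasure s + p.toOuterMeasure sᶜ = 1 := by
  rw [PMF.toOuterMeasure_apply, PMF.toOuterMeasure_apply, ← ENNReal.tsum_add, ← p.tsum_coe]
  exact tsum_congr fun a => Set.indicator_self_add_compl_apply s p a

theorem toOuterMeasure_le_one (p : PMF α) (s : Set α) : p.toOuterMeasure s ≤ 1 :=
  (toOuterMeasure_add_compl p s) ▸ le_self_add

theorem mul_le_toOuterMeasure_bind (p : PMF α) (f : α → PMF β) (t : Set α) (s : Set β) (b : ℝ≥0∞)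
    (h : ∀ a ∈ p.support, a ∈ t → b ≤ (f a).toOuterMeasure s) :
    p.toOuterMeasure t * b ≤ (p.bind f).toOuterMeasure s := by
  rw [PMF.toOuterMeasure_bind_apply, PMF.toOuterMeasure_apply, ← ENNReal.tsum_mul_right]
  refine ENNReal.tsum_le_tsum fun a => ?_
  by_cases ha : a ∈ t
  · by_cases hs : a ∈ p.support
    · rw [Set.indicator_of_mem ha]
      exact mul_le_mul_right (h a hs ha) _
    · simp [ha, (p.apply_eq_zero_iff a).2 hs]
  · simp [ha]

theorem apply_mul_le_toOuterMeasure_bind (p : PMF α) (f : α → PMF β) (a : α) (s : Set β) :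
    p a * (f a).toOuterMeasure s ≤ (p.bind f).toOuterMeasure s := by
  rw [PMF.toOuterMeasure_bind_apply]
  exact ENNReal.le_tsum (f := fun a => p a * (f a).toOuterMeasure s) a

theorem le_toOuterMeasure_bind (p : PMF α) (f : α → PMF β) (s : Set β) (b : ℝ≥0∞)
    (h : ∀ a ∈ p.support, b ≤ (f a).toOuterMeasure s) :
    b ≤ (p.bind f).toOuterMeasure s := by
  refine le_trans ?_ (mul_le_toOuterMeasure_bind p f Set.univ s b fun a ha _ => h a ha)
  rw [(p.toOuterMeasure_apply_eq_one_iff Set.univ).2 (Set.subset_univ _), one_mul]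

/-- If all branches have probability at most `b`, and one of them falls short by `c`, then the
mixture falls short of `b` by `c` times the probability of this branch. -/
theorem toOuterMeasure_bind_add_le (p : PMF α) (f : α → PMF β) (s : Set β) (a₀ : α)
    {b c : ℝ≥0∞} (h : ∀ a ∈ p.support, (f a).toOuterMeasure s ≤ b)
    (h₀ : (f a₀).toOuterMeasure s + c ≤ b) :
    (p.bind f).toOuterMeasure s + p a₀ * c ≤ b := by
  classical
  have hb : ∑' a, p a * b = b := by rw [ENNReal.tsum_mul_right, p.tsum_coe, one_mul]
  have hc : ∑' a, (if a = a₀ then p a * c else 0) = p a₀ * c := by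
    rw [tsum_eq_single a₀ (fun a ha => by simp [ha])]
    simp
  rw [PMF.toOuterMeasure_bind_apply, ← hc, ← ENNReal.tsum_add, ← hb]
  refine ENNReal.tsum_le_tsum fun a => ?_
  by_cases hs : a ∈ p.support
  · split_ifs with ha
    · subst ha
      rw [← mul_add]
      exact mul_le_mul_right h₀ _
    · rw [add_zero]
      exact mul_le_mul_right (h a hs) _
  · simp [(p.apply_eq_zero_iff a).2 hs]

theorem toOuterMeasure_bind_le (p : PMF α) (f : α → PMF β) (s : Set β) {b : ℝ≥0∞}
    (h : ∀ a ∈ p.support, (f a).toOuterMeasure s ≤ b) : (p.bind f).toOuterMeasure s ≤ b := by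
  obtain ⟨a, ha⟩ := p.support_nonempty
  simpa using toOuterMeasure_bind_add_le p f s a (c := 0) h (by simpa using h a ha)

theorem some_mem_support_andThen {p : PMF (Option α)} {f : α → PMF (Option β)} {b : β} :
    some b ∈ (andThen p f).support ↔ ∃ a, some a ∈ p.support ∧ some b ∈ (f a).support := by
  rw [andThen, PMF.mem_support_bind_iff]
  constructor
  · rintro ⟨_ | a, ha, hb⟩
    · simp at hb
    · exact ⟨a, ha, hb⟩
  · rintro ⟨a, ha, hb⟩
    exact ⟨some a, ha, hb⟩

theorem mul_le_toOuterMeasure_andThen (p : PMF (Option α)) (f : α → PMF (Option β))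
    (P : α → Prop) (s : Set (Option β)) (b : ℝ≥0∞)
    (h : ∀ a, some a ∈ p.support → P a → b ≤ (f a).toOuterMeasure s) :
    p.toOuterMeasure {o | ∃ a, o = some a ∧ P a} * b ≤ (andThen p f).toOuterMeasure s := by
  refine mul_le_toOuterMeasure_bind p _ _ s b ?_
  rintro _ ha ⟨a, rfl, hP⟩
  exact h a ha hP

/-- If the event `s` has probability at most `b` after the outcomes with the property `P`, and at
most `b + c` after the others, then the composition has it with a probability of at most `b`, plus
`c` times the probability of missing `P`, plus the probability of not ending. -/
theorem toOuterMeasure_andThen_le (p : PMF (Option α)) (f : α → PMF (Option β)) (P : α → Prop)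
    (s : Set (Option β)) (b c : ℝ≥0∞)
    (h : ∀ a, some a ∈ p.support → P a → (f a).toOuterMeasure s ≤ b)
    (h' : ∀ a, some a ∈ p.support → (f a).toOuterMeasure s ≤ b + c) :
    (andThen p f).toOuterMeasure s ≤ p.toOuterMeasure {none} +
      (b + p.toOuterMeasure {o | ∃ a, o = some a ∧ P a}ᶜ * c) := by
  have hb : ∑' a, p a * b = b := by rw [ENNReal.tsum_mul_right, p.tsum_coe, one_mul]
  rw [andThen, PMF.toOuterMeasure_bind_apply, PMF.toOuterMeasure_apply, PMF.toOuterMeasure_apply,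
    ← ENNReal.tsum_mul_right, ← hb, ← ENNReal.tsum_add, ← ENNReal.tsum_add]
  refine ENNReal.tsum_le_tsum fun o => ?_
  match o with
  | none =>
    refine le_trans ?_ le_self_add
    rw [Set.indicator_of_mem (Set.mem_singleton none)]
    exact mul_le_of_le_one_right zero_le (toOuterMeasure_le_one _ _)
  | some a =>
    refine le_trans ?_ le_add_self
    by_cases hs : some a ∈ p.support
    · by_cases hP : P a
      · exact le_trans (mul_le_mul_right (h a hs hP) _) le_self_add
      · rw [Set.indicator_of_mem (by simpa using hP), ← mul_add]
        exact mul_le_mul_right (h' a hs) _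
    · simp [(p.apply_eq_zero_iff (some a)).2 hs]

theorem toOuterMeasure_andThen_le_add (p : PMF (Option α)) (f : α → PMF (Option β))
    (s : Set (Option β)) (b : ℝ≥0∞)
    (h : ∀ a, some a ∈ p.support → (f a).toOuterMeasure s ≤ b) :
    (andThen p f).toOuterMeasure s ≤ p.toOuterMeasure {none} + b := by
  simpa using toOuterMeasure_andThen_le p f (fun _ => True) s b 0 (fun a ha _ => h a ha)
    (by simpa using h)

end Probability

/-! ### Loop-erased random walk -/

theorem extendErase_eq_cons (w : V) (path : List V) :
    ∃ l, extendErase w path = w :: l ∧ (w :: l <:+ path ∨ l = path) := by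
  classical
  unfold extendErase
  split_ifs with h
  · have hne : path.dropWhile (fun x => decide (x ≠ w)) ≠ [] := by
      rw [Ne, List.dropWhile_eq_nil_iff]
      intro h'
      simpa using h' w h
    have hh : (path.dropWhile (fun x => decide (x ≠ w))).head hne = w := by
      have := List.head_dropWhile_not (fun x => decide (x ≠ w)) hne
      simpa using this
    refine ⟨(path.dropWhile (fun x => decide (x ≠ w))).tail, ?_, Or.inl ?_⟩
    · conv_lhs => rw [← List.cons_head_tail hne, hh]
    · have := List.dropWhile_suffix (l := path) (fun x => decide (x ≠ w))
      rw [← List.cons_head_tail hne, hh] at this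
      convert this
  · exact ⟨path, rfl, Or.inr rfl⟩

theorem extendErase_cons {H : SimpleGraph V} {u w : V} {l : List V} (h : H.Adj w u)
    (hl : (u :: l).IsChain H.Adj) :
    ∃ l', extendErase w (u :: l) = w :: l' ∧ (w :: l').IsChain H.Adj ∧
      (w :: l').getLast? = (u :: l).getLast? := by
  obtain ⟨l', h1, h2 | h2⟩ := extendErase_eq_cons w (u :: l)
  · refine ⟨l', h1, hl.suffix h2, ?_⟩
    obtain ⟨l₀, h3⟩ := h2
    rw [← h3, List.getLast?_append_of_ne_nil _ (by simp)]
  · subst h2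
    exact ⟨_, h1, List.isChain_cons_cons.2 ⟨h, hl⟩, by simp⟩

section Walk

variable [Fintype V] {G : SimpleGraph V} {A : Set V}

theorem loopErasedWalk_of_mem (n : ℕ) {u : V} (l : List V) (hu : u ∈ A) :
    loopErasedWalk G A n (u :: l) = PMF.pure (some (u :: l)) := by
  cases n <;> simp [loopErasedWalk, hu]

open Classical in
theorem loopErasedWalk_succ (n : ℕ) {u w : V} (l : List V) (hu : u ∉ A) (h : G.Adj u w) :
    ∃ hs : (Finset.univ.filter fun w => G.Adj u w).Nonempty,
      loopErasedWalk G A (n + 1) (u :: l) = (PMF.uniformOfFinset _ hs).bind fun w =>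
        loopErasedWalk G A n (extendErase w (u :: l)) := by
  have hs : (Finset.univ.filter fun w => G.Adj u w).Nonempty := ⟨w, by simpa using h⟩
  refine ⟨hs, ?_⟩
  rw [loopErasedWalk, if_neg hu, dif_pos hs]

theorem loopErasedWalk_support {n : ℕ} {u : V} {l q : List V} (hl : (u :: l).IsChain G.Adj)
    (hq : some q ∈ (loopErasedWalk G A n (u :: l)).support) :
    q.IsChain G.Adj ∧ q.getLast? = (u :: l).getLast? ∧ ∃ a ∈ A, q.head? = some a := by
  classical
  induction n generalizing u l with
  | zero =>
    by_cases hu : u ∈ A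
    · rw [loopErasedWalk_of_mem _ _ hu] at hq
      simp only [PMF.support_pure, Set.mem_singleton_iff, Option.some.injEq] at hq
      subst hq
      exact ⟨hl, rfl, u, hu, rfl⟩
    · simp [loopErasedWalk, hu] at hq
  | succ n ih =>
    by_cases hu : u ∈ A
    · rw [loopErasedWalk_of_mem _ _ hu] at hq
      simp only [PMF.support_pure, Set.mem_singleton_iff, Option.some.injEq] at hq
      subst hq
      exact ⟨hl, rfl, u, hu, rfl⟩
    · by_cases hw : ∃ w, G.Adj u w
      · obtain ⟨w, hw⟩ := hw
        obtain ⟨hs, he⟩ := loopErasedWalk_succ (A := A) n l hu hw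
        rw [he, PMF.mem_support_bind_iff] at hq
        obtain ⟨x, hx, hq⟩ := hq
        have hx : G.Adj u x := by simpa using hx
        obtain ⟨l', h1, h2, h3⟩ := extendErase_cons hx.symm hl
        rw [h1] at hq
        exact h3 ▸ ih h2 hq
      · have : ¬ (Finset.univ.filter fun w => G.Adj u w).Nonempty := by
          rintro ⟨w, h⟩
          exact hw ⟨w, by simpa using h⟩
        rw [loopErasedWalk, if_neg hu, dif_neg this] at hq
        simp at hq

open Classical in
theorem inv_card_le_uniformOfFinset {α : Type*} [Fintype α] {s : Finset α} (hs : s.Nonempty) {a : α}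
    (ha : a ∈ s) : ((Fintype.card α : ℝ≥0∞))⁻¹ ≤ PMF.uniformOfFinset s hs a := by
  rw [PMF.uniformOfFinset_apply_of_mem hs ha]
  exact ENNReal.inv_le_inv.2 (by exact_mod_cast Finset.card_le_univ s)

theorem inv_card_le_one [Nonempty V] : ((Fintype.card V : ℝ≥0∞))⁻¹ ≤ 1 := by
  rw [ENNReal.inv_le_one]
  exact_mod_cast Fintype.card_pos

/-- The random walk follows a prescribed walk of a subgraph `H` with at least the probability
`n⁻¹` per step, where `n` is the number of nodes. Loop erasure keeps a path of `H` a path of `H`. -/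
theorem loopErasedWalk_isChain_prob {H : SimpleGraph V} (hH : H ≤ G) {u a : V} (p : H.Walk u a)
    (ha : a ∈ A) {n : ℕ} (hn : p.length ≤ n) {l : List V} (hl : (u :: l).IsChain H.Adj) :
    ((Fintype.card V : ℝ≥0∞))⁻¹ ^ p.length ≤ (loopErasedWalk G A n (u :: l)).toOuterMeasure
      {o | ∃ q, o = some q ∧ q.IsChain H.Adj} := by
  classical
  have : Nonempty V := ⟨u⟩
  induction p generalizing n l with
  | nil =>
    rw [loopErasedWalk_of_mem _ _ ha, PMF.toOuterMeasure_pure_apply, if_pos ⟨_, rfl, hl⟩]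
    simp
  | @cons u w a h p ih =>
    by_cases hu : u ∈ A
    · rw [loopErasedWalk_of_mem _ _ hu, PMF.toOuterMeasure_pure_apply, if_pos ⟨_, rfl, hl⟩]
      exact pow_le_one' inv_card_le_one _
    · obtain ⟨n, rfl⟩ : ∃ k, n = k + 1 := ⟨n - 1, by simp at hn; omega⟩
      obtain ⟨hs, he⟩ := loopErasedWalk_succ (A := A) n l hu (hH h)
      rw [he]
      refine le_trans ?_ (apply_mul_le_toOuterMeasure_bind _ _ w _)
      obtain ⟨l', h1, h2, -⟩ := extendErase_cons h.symm hl
      rw [SimpleGraph.Walk.length_cons, pow_succ', h1]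
      exact mul_le_mul' (inv_card_le_uniformOfFinset hs (by simpa using hH h))
        (ih ha (by simpa using hn) h2)

theorem loopErasedWalk_none_antitone (path : List V) :
    Antitone fun n => (loopErasedWalk G A n path).toOuterMeasure {none} := by
  classical
  refine antitone_nat_of_succ_le fun n => ?_
  induction n generalizing path with
  | zero =>
    match path with
    | [] => simp [loopErasedWalk]
    | u :: l =>
      by_cases hu : u ∈ A
      · simp [loopErasedWalk_of_mem _ _ hu]
      · refine (toOuterMeasure_le_one _ _).trans ?_
        simp [loopErasedWalk, hu]
  | succ n ih =>
    match path with
    | [] => simp [loopErasedWalk]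
    | u :: l =>
      by_cases hu : u ∈ A
      · simp [loopErasedWalk_of_mem _ _ hu]
      · by_cases hw : ∃ w, G.Adj u w
        · obtain ⟨w, hw⟩ := hw
          obtain ⟨hs, he⟩ := loopErasedWalk_succ (A := A) n l hu hw
          obtain ⟨hs', he'⟩ := loopErasedWalk_succ (A := A) (n + 1) l hu hw
          rw [he, he', PMF.toOuterMeasure_bind_apply, PMF.toOuterMeasure_bind_apply]
          exact ENNReal.tsum_le_tsum fun x => mul_le_mul_right (ih _) _
        · have : ¬ (Finset.univ.filter fun w => G.Adj u w).Nonempty := by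
            rintro ⟨w, h⟩
            exact hw ⟨w, by simpa using h⟩
          rw [loopErasedWalk, if_neg hu, dif_neg this, loopErasedWalk, if_neg hu, dif_neg this]

/-- If every walk is still under way after `k` steps with probability at most `b`, then the walks
from a node at distance `d` from `A` have, after `d` further steps, a probability smaller by
`n⁻ᵈ b`. -/
theorem loopErasedWalk_none_add_le {k : ℕ} {b : ℝ≥0∞}
    (hb : ∀ u l, (loopErasedWalk G A k (u :: l)).toOuterMeasure {none} ≤ b)
    {u a : V} (p : G.Walk u a) (ha : a ∈ A) (l : List V) :
    (loopErasedWalk G A (k + p.length) (u :: l)).toOuterMeasure {none} +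
      ((Fintype.card V : ℝ≥0∞))⁻¹ ^ p.length * b ≤ b := by
  classical
  have : Nonempty V := ⟨u⟩
  induction p generalizing l with
  | nil => simp [loopErasedWalk_of_mem _ _ ha]
  | @cons u w a h p ih =>
    by_cases hu : u ∈ A
    · rw [loopErasedWalk_of_mem _ _ hu, PMF.toOuterMeasure_pure_apply, if_neg (by simp), zero_add]
      exact mul_le_of_le_one_left (zero_le) (pow_le_one' inv_card_le_one _)
    · obtain ⟨hs, he⟩ := loopErasedWalk_succ (A := A) (k + p.length) l hu h
      rw [SimpleGraph.Walk.length_cons, ← add_assoc, he]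
      refine le_trans (add_le_add_right ?_ _)
        (toOuterMeasure_bind_add_le _ _ _ w
          (c := ((Fintype.card V : ℝ≥0∞))⁻¹ ^ p.length * b) (fun x _ => ?_) ?_)
      · rw [pow_succ', mul_assoc]
        exact mul_le_mul_left (inv_card_le_uniformOfFinset hs (by simpa using h)) _
      · obtain ⟨l', h1, -⟩ := extendErase_eq_cons x (u :: l)
        rw [h1]
        exact (loopErasedWalk_none_antitone _ (Nat.le_add_right _ _)).trans (hb _ _)
      · obtain ⟨l', h1, -⟩ := extendErase_eq_cons w (u :: l)
        rw [h1]
        exact ih ha l'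

/-- A bound, tending to 0, for the probability that a loop-erased walk is still under way at the
time limit. -/
def walkTail (V : Type*) [Fintype V] (limit : ℕ) : ℝ≥0∞ :=
  (1 - ((Fintype.card V : ℝ≥0∞))⁻¹ ^ Fintype.card V) ^ (limit / Fintype.card V)

theorem tendsto_walkTail [Nonempty V] :
    Filter.Tendsto (walkTail V) Filter.atTop (nhds 0) := by
  refine (ENNReal.tendsto_pow_atTop_nhds_zero_of_lt_one ?_).comp
    (Nat.tendsto_div_const_atTop Fintype.card_ne_zero)
  refine ENNReal.sub_lt_self ENNReal.one_ne_top one_ne_zero (pow_ne_zero _ ?_)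
  simp

theorem loopErasedWalk_none_le (hG : G.Connected) (hA : A.Nonempty) (limit : ℕ) (u : V)
    (l : List V) :
    (loopErasedWalk G A limit (u :: l)).toOuterMeasure {none} ≤ walkTail V limit := by
  classical
  have : Nonempty V := ⟨u⟩
  obtain ⟨a, ha⟩ := hA
  have key : ∀ j : ℕ, ∀ u l,
      (loopErasedWalk G A (j * Fintype.card V) (u :: l)).toOuterMeasure {none} ≤
        (1 - ((Fintype.card V : ℝ≥0∞))⁻¹ ^ Fintype.card V) ^ j := by
    intro j
    induction j with
    | zero => exact fun u l => by simpa using toOuterMeasure_le_one _ _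
    | succ j ih =>
      intro u l
      obtain ⟨p, hp⟩ := (hG.preconnected u a).exists_isPath
      have hlen : p.length ≤ Fintype.card V := hp.length_lt.le
      have h1 := loopErasedWalk_none_add_le ih p ha l
      set b : ℝ≥0∞ := (1 - ((Fintype.card V : ℝ≥0∞))⁻¹ ^ Fintype.card V) ^ j with hbdef
      have hb1 : b ≤ 1 := pow_le_one' tsub_le_self _
      rw [pow_succ', ← hbdef, ENNReal.sub_mul (fun _ _ => ne_top_of_le_ne_top ENNReal.one_ne_top hb1),
        one_mul]
      refine ENNReal.le_sub_of_add_le_right ?_ (le_trans (add_le_add ?_ ?_) h1)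
      · exact ENNReal.mul_ne_top (by simp) (ne_top_of_le_ne_top ENNReal.one_ne_top hb1)
      · refine loopErasedWalk_none_antitone _ ?_
        rw [Nat.succ_mul]
        omega
      · exact mul_le_mul_left (pow_le_pow_right_of_le_one' inv_card_le_one hlen) _
  exact (loopErasedWalk_none_antitone _ (Nat.div_mul_le_self _ _)).trans (key _ u l)

end Walk

/-! ### Wilson's algorithm -/

theorem pathEdges_le {H : SimpleGraph V} {q : List V} (hq : q.IsChain H.Adj) :
    pathEdges q ≤ H := by
  induction q with
  | nil => exact bot_le
  | cons a q ih =>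
    cases q with
    | nil => exact bot_le
    | cons b q =>
      rw [List.isChain_cons_cons] at hq
      exact sup_le ((SimpleGraph.edge_le_iff _).2 (Or.inr hq.1)) (ih hq.2)

theorem pathEdges_reachable {a : V} {q : List V} {x : V} (hx : x ∈ a :: q) :
    (pathEdges (a :: q)).Reachable a x := by
  induction q generalizing a with
  | nil =>
    obtain rfl : x = a := by simpa using hx
    exact SimpleGraph.Reachable.refl _
  | cons b q ih =>
    rcases List.mem_cons.1 hx with rfl | hx
    · exact SimpleGraph.Reachable.refl _
    · refine SimpleGraph.Reachable.trans ?_ ((ih hx).mono le_sup_right)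
      by_cases hab : a = b
      · subst hab
        exact SimpleGraph.Reachable.refl _
      · refine SimpleGraph.Adj.reachable ?_
        exact Or.inl ((SimpleGraph.edge_adj ..).2 ⟨Or.inl ⟨rfl, rfl⟩, hab⟩)

/-- `T` is a subgraph of `H` that connects the nodes of `A`. -/
def Spans (H : SimpleGraph V) (A : Set V) (T : SimpleGraph V) : Prop :=
  T ≤ H ∧ ∀ a ∈ A, ∀ b ∈ A, T.Reachable a b

theorem Spans.attach {H T : SimpleGraph V} {A : Set V} {q : List V} {a : V} (h : Spans H A T)
    (hq : q.IsChain H.Adj) (ha : a ∈ A) (hqa : q.head? = some a) :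
    Spans H (A ∪ {x | x ∈ q}) (T ⊔ pathEdges q) := by
  obtain ⟨q, rfl⟩ : ∃ q', q = a :: q' := by
    cases q with
    | nil => simp at hqa
    | cons b q => exact ⟨q, by simpa using hqa⟩
  refine ⟨sup_le h.1 (pathEdges_le hq), ?_⟩
  have key : ∀ x ∈ A ∪ {x | x ∈ a :: q}, (T ⊔ pathEdges (a :: q)).Reachable a x := by
    rintro x (hx | hx)
    · exact (h.2 a ha x hx).mono le_sup_left
    · exact (pathEdges_reachable hx).mono le_sup_right
  exact fun x hx y hy => (key x hx).symm.trans (key y hy)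

theorem Spans.connected [Nonempty V] {H T : SimpleGraph V} {A : Set V} (h : Spans H A T)
    (hA : ∀ v, v ∈ A) : T.Connected :=
  ⟨fun a b => h.2 a (hA a) b (hA b)⟩

theorem spans_singleton (H : SimpleGraph V) (r : V) : Spans H {r} ⊥ := by
  refine ⟨bot_le, ?_⟩
  rintro a rfl b rfl
  exact SimpleGraph.Reachable.refl _

section Wilson

variable [Fintype V] {G : SimpleGraph V}

theorem wilsonLoop_support [Nonempty V] {limit : ℕ} {order : List V} {A : Set V} {T T' : SimpleGraph V}
    (h : Spans G A T) (hA : ∀ v, v ∈ A ∨ v ∈ order)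
    (hT' : some T' ∈ (wilsonLoop G limit order A T).support) : T' ≤ G ∧ T'.Connected := by
  induction order generalizing A T with
  | nil =>
    simp only [wilsonLoop, PMF.support_pure, Set.mem_singleton_iff, Option.some.injEq] at hT'
    subst hT'
    exact ⟨h.1, h.connected fun v => by simpa using hA v⟩
  | cons i order ih =>
    rw [wilsonLoop, some_mem_support_andThen] at hT'
    obtain ⟨q, hq, hT'⟩ := hT'
    obtain ⟨h1, h2, a, ha, h3⟩ := loopErasedWalk_support (List.isChain_singleton i) hq
    refine ih (h.attach h1 ha h3) (fun v => ?_) hT'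
    rcases hA v with hv | hv
    · exact Or.inl (Or.inl hv)
    · rcases List.mem_cons.1 hv with rfl | hv
      · exact Or.inl (Or.inr (List.mem_of_getLast? (by simpa using h2)))
      · exact Or.inr hv

theorem wilsonLoop_none_le (hG : G.Connected) (limit : ℕ) (order : List V) {A : Set V}
    (hA : A.Nonempty) (T : SimpleGraph V) :
    (wilsonLoop G limit order A T).toOuterMeasure {none} ≤ order.length * walkTail V limit := by
  induction order generalizing A T with
  | nil => simp [wilsonLoop]
  | cons i order ih =>
    rw [wilsonLoop, List.length_cons, Nat.cast_succ, add_mul, one_mul, add_comm]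
    refine (toOuterMeasure_andThen_le_add _ _ _ _ fun q _ => ih (hA.mono Set.subset_union_left) _).trans
      (add_le_add_left (loopErasedWalk_none_le hG hA limit i []) _)

/-- While the tree is part of the spanning tree `T₀`, every new branch follows `T₀` with probability
at least `n⁻ⁿ`, and every branch that is not trivial adds a node. -/
theorem wilsonLoop_isTree_prob [Nonempty V] {T₀ : SimpleGraph V} (hT₀ : T₀.IsTree) (hle : T₀ ≤ G) {limit : ℕ}
    (hlimit : Fintype.card V ≤ limit) {order : List V} {A : Set V} {T : SimpleGraph V}
    (hA : ∀ v, v ∈ A ∨ v ∈ order) (hne : A.Nonempty) (h : Spans T₀ A T) :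
    (((Fintype.card V : ℝ≥0∞))⁻¹ ^ Fintype.card V) ^ Aᶜ.ncard ≤
      (wilsonLoop G limit order A T).toOuterMeasure {o | ∃ T', o = some T' ∧ T' = T₀} := by
  classical
  induction order generalizing A T with
  | nil =>
    -- A tree is minimal among the connected graphs on all nodes.
    have hT : T = T₀ := by
      have hc := h.connected fun v => by simpa using hA v
      exact le_antisymm h.1
        ((SimpleGraph.isTree_iff_minimal_connected.1 hT₀).2 hc h.1)
    rw [wilsonLoop, PMF.toOuterMeasure_pure_apply, if_pos ⟨T, rfl, hT⟩]
    exact pow_le_one' (pow_le_one' inv_card_le_one _) _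
  | cons i order ih =>
    rw [wilsonLoop]
    by_cases hi : i ∈ A
    · have hA' : A ∪ {x | x ∈ [i]} = A := by
        ext x
        simp only [List.mem_singleton, Set.mem_union, Set.mem_ofPred_eq, or_iff_left_iff_imp]
        rintro rfl
        exact hi
      rw [loopErasedWalk_of_mem _ _ hi, andThen, PMF.pure_bind]
      simp only [hA', pathEdges, sup_bot_eq]
      refine ih (fun v => ?_) hne h
      rcases hA v with hv | hv
      · exact Or.inl hv
      · rcases List.mem_cons.1 hv with rfl | hv
        · exact Or.inl hi
        · exact Or.inr hv
    · obtain ⟨a, ha⟩ := hne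
      obtain ⟨p, hp⟩ := (hT₀.connected.preconnected i a).exists_isPath
      have hlen : p.length ≤ Fintype.card V := hp.length_lt.le
      have hc : 1 ≤ Aᶜ.ncard := (Set.ncard_pos (Set.toFinite _)).2 ⟨i, hi⟩
      obtain ⟨d, hd⟩ : ∃ d, Aᶜ.ncard = d + 1 := ⟨Aᶜ.ncard - 1, by omega⟩
      rw [hd, pow_succ']
      refine le_trans (mul_le_mul_left ?_ _) (mul_le_toOuterMeasure_andThen _ _
        (fun q => q.IsChain T₀.Adj) _ _ fun q hq hqc => ?_)
      · exact le_trans (pow_le_pow_right_of_le_one' inv_card_le_one hlen)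
          (loopErasedWalk_isChain_prob hle p ha (hlen.trans hlimit) (List.isChain_singleton i))
      · obtain ⟨h1, h2, b, hb, h3⟩ := loopErasedWalk_support (List.isChain_singleton i) hq
        have hiq : i ∈ q := List.mem_of_getLast? (by simpa using h2)
        refine le_trans (pow_le_pow_right_of_le_one' (pow_le_one' inv_card_le_one _) ?_)
          (ih (fun v => ?_) ⟨a, Or.inl ha⟩ (h.attach hqc hb h3))
        · have : (A ∪ {x | x ∈ q})ᶜ.ncard < Aᶜ.ncard := by
            refine Set.ncard_lt_ncard ?_ (Set.toFinite _)
            exact ⟨Set.compl_subset_compl.2 Set.subset_union_left,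
              fun hsub => hsub hi (Or.inr hiq)⟩
          omega
        · rcases hA v with hv | hv
          · exact Or.inl (Or.inl hv)
          · rcases List.mem_cons.1 hv with rfl | hv
            · exact Or.inl (Or.inr hiq)
            · exact Or.inr hv

theorem wilson_support [Nonempty V] {r : V} {order : List V} (ho : ∀ v, v ∈ order) {limit : ℕ}
    {T : SimpleGraph V} (hT : some T ∈ (wilson G r order limit).support) :
    T ≤ G ∧ T.Connected :=
  wilsonLoop_support (spans_singleton G r) (fun v => Or.inr (ho v)) hT

theorem wilson_none_le (hG : G.Connected) (r : V) (order : List V) (limit : ℕ) :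
    (wilson G r order limit).toOuterMeasure {none} ≤ order.length * walkTail V limit :=
  wilsonLoop_none_le hG limit order (Set.singleton_nonempty r) ⊥

theorem wilson_isTree_prob [Nonempty V] {T₀ : SimpleGraph V} (hT₀ : T₀.IsTree) (hle : T₀ ≤ G) (r : V)
    {order : List V} (ho : ∀ v, v ∈ order) {limit : ℕ} (hlimit : Fintype.card V ≤ limit) :
    (((Fintype.card V : ℝ≥0∞))⁻¹ ^ Fintype.card V) ^ Fintype.card V ≤
      (wilson G r order limit).toOuterMeasure {o | ∃ T', o = some T' ∧ T' = T₀} := by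
  refine le_trans (pow_le_pow_right_of_le_one' (pow_le_one' inv_card_le_one _) ?_)
    (wilsonLoop_isTree_prob hT₀ hle hlimit (fun v => Or.inr (ho v)) (Set.singleton_nonempty r)
      (spans_singleton T₀ r))
  rw [← Nat.card_eq_fintype_card]
  exact Set.ncard_le_card _

end Wilson

/-! ### Schedules move by move -/

section Schedules

variable {G : SimpleGraph V} {S l : List (Move V)} {m : Move V}

theorem run_append_singleton : run G (S ++ [m]) = step G (run G S) m := by
  simp [run]

theorem configAt_append_of_le {t : ℕ} (ht : t ≤ S.length) :
    configAt G (S ++ l) t = configAt G S t := by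
  rw [configAt, configAt, List.take_append_of_le_length ht]

theorem configAt_of_length_le {t : ℕ} (ht : S.length ≤ t) : configAt G S t = run G S := by
  rw [configAt, List.take_of_length_le ht]

theorem IsSchedule.of_append (h : IsSchedule G (S ++ l)) : IsSchedule G S := by
  intro t m hm
  obtain ⟨ht, -⟩ := List.getElem?_eq_some_iff.1 hm
  have := h t m (by rw [List.getElem?_append_left ht, hm])
  rwa [configAt_append_of_le ht.le] at this

theorem isSchedule_append_singleton :
    IsSchedule G (S ++ [m]) ↔ IsSchedule G S ∧ Legal G (run G S) m := by
  constructor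
  · refine fun h => ⟨h.of_append, ?_⟩
    have := h S.length m (by simp)
    rwa [configAt_append_of_le le_rfl, configAt_of_length_le le_rfl] at this
  · rintro ⟨h1, h2⟩ t m' hm'
    rcases lt_trichotomy t S.length with ht | rfl | ht
    · rw [configAt_append_of_le ht.le]
      exact h1 t m' (by rwa [List.getElem?_append_left ht] at hm')
    · obtain rfl : m = m' := by simpa using hm'
      rwa [configAt_append_of_le le_rfl, configAt_of_length_le le_rfl]
    · rw [List.getElem?_eq_none (by simpa using ht)] at hm'
      exact absurd hm' (by simp)

theorem isMonotone_append : IsMonotone G (S ++ l) ↔ IsMonotone G S ∧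
    ∀ t, S.length ≤ t →
      (configAt G (S ++ l) t).clear ⊆ (configAt G (S ++ l) (t + 1)).clear := by
  constructor
  · refine fun h => ⟨fun t => ?_, fun t _ => h t⟩
    rcases lt_or_ge t S.length with ht | ht
    · have := h t
      rwa [configAt_append_of_le ht.le, configAt_append_of_le ht] at this
    · rw [configAt_of_length_le ht, configAt_of_length_le (by omega)]
  · rintro ⟨h1, h2⟩ t
    rcases lt_or_ge t S.length with ht | ht
    · rw [configAt_append_of_le ht.le, configAt_append_of_le ht]
      exact h1 t
    · exact h2 t ht

theorem isMonotone_append_singleton : IsMonotone G (S ++ [m]) ↔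
    IsMonotone G S ∧ (run G S).clear ⊆ (step G (run G S) m).clear := by
  rw [isMonotone_append, ← run_append_singleton]
  refine and_congr_right fun _ => ⟨fun h => ?_, fun h t ht => ?_⟩
  · have := h S.length le_rfl
    rwa [configAt_append_of_le le_rfl, configAt_of_length_le le_rfl,
      configAt_of_length_le (by simp)] at this
  · rcases ht.eq_or_lt with rfl | ht
    · rwa [configAt_append_of_le le_rfl, configAt_of_length_le le_rfl,
        configAt_of_length_le (by simp)]
    · rw [configAt_of_length_le (by simpa using ht), configAt_of_length_le (by simp; omega)]

theorem IsConnected.append_singleton (h : IsConnected G S)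
    (hc : (G.induce (run G (S ++ [m])).clear).Connected) : IsConnected G (S ++ [m]) := by
  intro t h1 ht
  rcases le_or_gt t S.length with ht' | ht'
  · rw [configAt_append_of_le ht']
    exact h t h1 ht'
  · rwa [configAt_of_length_le (by simpa using ht')]

theorem snMax_append_singleton [Fintype V] :
    snMax G (S ++ [m]) = max (snMax G S) (∑ v, (run G (S ++ [m])).searchers v) := by
  rw [snMax, snMax, List.length_append, List.length_singleton, Finset.range_add_one,
    Finset.sup_insert, max_comm]
  congr 1
  · refine Finset.sup_congr rfl fun t ht => ?_
    rw [sn, sn, configAt_append_of_le (by simpa [Nat.lt_succ_iff] using ht)]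
  · rw [sn, configAt_of_length_le (by simp)]

theorem sum_searchers_le_snMax [Fintype V] : ∑ v, (run G S).searchers v ≤ snMax G S := by
  have := Finset.le_sup (f := sn G S) (Finset.mem_range.2 (Nat.lt_succ_self S.length))
  rwa [sn, configAt_of_length_le le_rfl] at this

end Schedules

/-! ### Recontamination -/

section Recontamination

variable {G : SimpleGraph V} {c : Config V} {m : Move V}

/-- No searcher stands on a dirty node, and there is one on every clear node that has a dirty
neighbour. All configurations of the node game have this property. -/
def Guarded (G : SimpleGraph V) (c : Config V) : Prop :=
  (∀ x ∈ c.dirty, c.searchers x = 0) ∧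
    ∀ w ∈ c.clear, ∀ z ∈ c.dirty, G.Adj w z → c.searchers w ≠ 0

theorem guarded_step (c : Config V) (m : Move V) : Guarded G (step G c m) := by
  classical
  refine ⟨?_, ?_⟩
  · rintro x ⟨y, -, p, -, hp⟩
    exact hp x p.start_mem_support
  · rintro w hw z ⟨y, hy, p, -, hp⟩ hwz h0
    refine hw ⟨y, hy, (SimpleGraph.Walk.cons hwz p).bypass,
      SimpleGraph.Walk.bypass_isPath _, fun a ha => ?_⟩
    have := SimpleGraph.Walk.support_bypass_subset_support _ ha
    rw [SimpleGraph.Walk.support_cons, List.mem_cons] at this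
    rcases this with rfl | h
    · exact h0
    · exact hp a h

theorem guarded_run (S : List (Move V)) : Guarded G (run G S) := by
  induction S using List.reverseRecOn with
  | nil => exact ⟨fun _ _ => rfl, fun w hw => absurd (Set.mem_univ w) hw⟩
  | append_singleton S m _ =>
    rw [run_append_singleton]
    exact guarded_step _ _

theorem mem_clear_of_searchers_ne_zero (hc : Guarded G c) {u : V} (hu : c.searchers u ≠ 0) :
    u ∈ c.clear := fun h => hu (hc.1 u h)

/-- A move causes no recontamination if it leaves a searcher on every clear node with a dirty
neighbour that stays empty. -/
theorem clear_subset_step (h : ∀ w ∈ c.clear, ∀ z ∈ c.dirty, G.Adj w z →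
    moveSearchers c.searchers m z = 0 → moveSearchers c.searchers m w ≠ 0) :
    c.clear ⊆ (step G c m).clear := by
  rintro x hx ⟨y, hy, p, -, hp⟩
  induction p with
  | nil => exact hx hy
  | @cons x w y hxw p ih =>
    have hp' : ∀ a ∈ p.support, moveSearchers c.searchers m a = 0 := fun a ha =>
      hp a (by simp [ha])
    by_cases hw : w ∈ c.dirty
    · exact h x hx w hw hxw (hp' w p.start_mem_support) (hp x (by simp))
    · exact ih hw hy hp'

theorem step_clear (h : c.clear ⊆ (step G c m).clear) :
    (step G c m).clear = c.clear ∪ {x | moveSearchers c.searchers m x ≠ 0} := by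
  ext x
  constructor
  · intro hx
    by_contra hx'
    simp only [Set.mem_union, Set.mem_ofPred_eq, not_or, not_not] at hx'
    refine hx ⟨x, not_not.1 hx'.1, SimpleGraph.Walk.nil, by simp, ?_⟩
    simpa using hx'.2
  · rintro (hx | hx)
    · exact h hx
    · exact mem_clear_of_searchers_ne_zero (guarded_step c m) hx

theorem step_place_subset (hc : Guarded G c) (x : V) :
    c.clear ⊆ (step G c (.place x)).clear := by
  refine clear_subset_step fun w hw z hz hwz _ => ?_
  have := hc.2 w hw z hz hwz
  simp only [moveSearchers]
  split_ifs <;> omega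

theorem step_place_clear (hc : Guarded G c) (x : V) :
    (step G c (.place x)).clear = insert x c.clear := by
  rw [step_clear (step_place_subset hc x)]
  ext w
  simp only [moveSearchers, Set.mem_union, Set.mem_ofPred_eq, Set.mem_insert_iff]
  have := mem_clear_of_searchers_ne_zero hc (u := w)
  split_ifs with h
  · simp [h]
  · tauto

theorem step_slide_clear (hc : Guarded G c) {u v : V} (hu : 0 < c.searchers u) (huv : u ≠ v)
    (h : c.clear ⊆ (step G c (.slide u v)).clear) :
    (step G c (.slide u v)).clear = insert v c.clear := by
  rw [step_clear h]
  ext w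
  simp only [moveSearchers, Set.mem_union, Set.mem_ofPred_eq, Set.mem_insert_iff]
  have := mem_clear_of_searchers_ne_zero hc (u := w)
  split_ifs with h1 h2
  · subst h1
    have := this hu.ne'
    tauto
  · simp [h2]
  · tauto

theorem step_slide_subset (hc : Guarded G c) {u v : V} (huv : u ≠ v)
    (h : 2 ≤ c.searchers u ∨ ∀ z ∈ c.dirty, G.Adj u z → z = v) :
    c.clear ⊆ (step G c (.slide u v)).clear := by
  refine clear_subset_step fun w hw z hz hwz h0 => ?_
  have hne := hc.2 w hw z hz hwz
  simp only [moveSearchers] at h0 ⊢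
  split_ifs with h1 h2
  · subst h1
    rcases h with h | h
    · omega
    · obtain rfl := h z hz hwz
      simp [huv.symm] at h0
  · omega
  · exact hne

/-- The last searcher on a node may leave it without recontamination only towards the single dirty
neighbour of this node. -/
theorem eq_of_step_slide_subset {u v : V} (hu : c.searchers u = 1) (huc : u ∈ c.clear)
    (h : c.clear ⊆ (step G c (.slide u v)).clear) (hc : Guarded G c) {z : V}
    (hz : z ∈ c.dirty) (huz : G.Adj u z) : z = v := by
  by_contra hne
  have hzu : z ≠ u := huz.ne'
  have hz' : z ∈ (step G c (.slide u v)).dirty := by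
    refine ⟨z, hz, SimpleGraph.Walk.nil, by simp, ?_⟩
    simpa [moveSearchers, hne, hzu] using hc.1 z hz
  refine (guarded_step c (.slide u v)).2 u (h huc) z hz' huz ?_
  simp [step, moveSearchers, hu]

theorem sum_moveSearchers_place [Fintype V] (k : V → ℕ) (x : V) :
    ∑ v, moveSearchers k (.place x) v = ∑ v, k v + 1 := by
  classical
  have : ∀ v, moveSearchers k (.place x) v = k v + if v = x then 1 else 0 := by
    intro v
    simp only [moveSearchers]
    split_ifs <;> rfl
  simp [this, Finset.sum_add_distrib]

theorem sum_moveSearchers_slide [Fintype V] (k : V → ℕ) {u v : V} (hu : 0 < k u) (huv : u ≠ v) :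
    ∑ w, moveSearchers k (.slide u v) w = ∑ w, k w := by
  classical
  have h : ∀ w, moveSearchers k (.slide u v) w + (if w = u then 1 else 0) =
      k w + if w = v then 1 else 0 := by
    intro w
    simp only [moveSearchers]
    split_ifs with h1 h2
    · exact absurd (h1.symm.trans h2) huv
    · subst h1
      omega
    · rfl
    · rfl
  have := Finset.sum_congr (rfl : (Finset.univ : Finset V) = Finset.univ) fun w _ => h w
  simpa [Finset.sum_add_distrib] using this

end Recontamination

/-! ### Searches in progress -/

/-- A rooted IMC search that need not have cleared all nodes yet. The empty schedule is excluded by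
requiring that the root is clear. -/
structure IsPartial (G : SimpleGraph V) (x : V) (S : List (Move V)) : Prop where
  schedule : IsSchedule G S
  rooted : IsRooted x S
  internal : IsInternal S
  monotone : IsMonotone G S
  connected : IsConnected G S
  root_clear : x ∈ (run G S).clear

section Partial

variable {G : SimpleGraph V} {x : V} {S : List (Move V)}

theorem IsPartial.isIMCClearing (h : IsPartial G x S) (hd : (run G S).dirty = ∅) :
    IsIMCClearing G x S :=
  ⟨h.schedule, h.rooted, h.internal, h.monotone, h.connected, by
    rw [IsNodeClearing, Config.clear, hd, Set.compl_empty]⟩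

theorem IsPartial.induce_connected (h : IsPartial G x S) :
    (G.induce (run G S).clear).Connected := by
  rw [← configAt_of_length_le le_rfl]
  refine h.connected _ ?_ le_rfl
  cases S with
  | nil => exact absurd (Set.mem_univ x) h.root_clear
  | cons m S => simp

theorem run_place (x : V) : (run G [Move.place x]).clear = {x} := by
  have : run G [Move.place x] = step G (run G []) (.place x) := rfl
  rw [this, step_place_clear (guarded_run [])]
  ext w
  simp [run, Config.initial, Config.clear]

theorem isPartial_place (x : V) : IsPartial G x [Move.place x] where
  schedule := by
    have := (isSchedule_append_singleton (G := G) (S := []) (m := .place x)).2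
      ⟨fun t m h => by simp at h, trivial⟩
    simpa using this
  rooted := by
    intro v hv
    simpa using hv
  internal := by
    intro u hu
    simp at hu
  monotone := by
    have := (isMonotone_append_singleton (G := G) (S := []) (m := .place x)).2
      ⟨fun t => by simp [configAt], step_place_subset (guarded_run []) x⟩
    simpa using this
  connected := by
    intro t h1 h2
    obtain rfl : t = 1 := le_antisymm (by simpa using h2) h1
    rw [configAt_of_length_le (by simp), run_place]
    exact SimpleGraph.Connected.of_subsingleton
  root_clear := by
    rw [run_place]
    rfl

theorem IsPartial.clear_place (h : IsPartial G x S) :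
    (run G (S ++ [Move.place x])).clear = (run G S).clear := by
  rw [run_append_singleton, step_place_clear (guarded_run S), Set.insert_eq_of_mem h.root_clear]

theorem IsPartial.dirty_place (h : IsPartial G x S) :
    (run G (S ++ [Move.place x])).dirty = (run G S).dirty := by
  have := congrArg compl h.clear_place
  simpa [Config.clear] using this

theorem IsPartial.place (h : IsPartial G x S) : IsPartial G x (S ++ [Move.place x]) where
  schedule := isSchedule_append_singleton.2 ⟨h.schedule, trivial⟩
  rooted := by
    intro v hv
    rcases List.mem_append.1 hv with hv | hv
    · exact h.rooted v hv
    · simpa using hv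
  internal := by
    intro u hu
    rcases List.mem_append.1 hu with hu | hu
    · exact h.internal u hu
    · simp at hu
  monotone := isMonotone_append_singleton.2 ⟨h.monotone, step_place_subset (guarded_run S) x⟩
  connected := h.connected.append_singleton (by
    rw [h.clear_place]
    exact h.induce_connected)
  root_clear := by
    rw [h.clear_place]
    exact h.root_clear

theorem run_slide_clear {u v : V} (hl : Legal G (run G S) (.slide u v))
    (hm : (run G S).clear ⊆ (step G (run G S) (.slide u v)).clear) :
    (run G (S ++ [Move.slide u v])).clear = insert v (run G S).clear := by
  rw [run_append_singleton, step_slide_clear (guarded_run S) hl.1 hl.2.ne hm]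

theorem IsPartial.slide (h : IsPartial G x S) {u v : V} (hl : Legal G (run G S) (.slide u v))
    (hm : (run G S).clear ⊆ (step G (run G S) (.slide u v)).clear) :
    IsPartial G x (S ++ [Move.slide u v]) where
  schedule := isSchedule_append_singleton.2 ⟨h.schedule, hl⟩
  rooted := by
    intro v hv
    rcases List.mem_append.1 hv with hv | hv
    · exact h.rooted v hv
    · simp at hv
  internal := by
    intro u hu
    rcases List.mem_append.1 hu with hu | hu
    · exact h.internal u hu
    · simp at hu
  monotone := isMonotone_append_singleton.2 ⟨h.monotone, hm⟩
  connected := h.connected.append_singleton (by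
    rw [run_slide_clear hl hm]
    have hu : u ∈ (run G S).clear := mem_clear_of_searchers_ne_zero (guarded_run S) hl.1.ne'
    have := SimpleGraph.induce_union_connected h.induce_connected.preconnected
      (SimpleGraph.induce_pair_connected_of_adj hl.2).preconnected ⟨u, hu, by simp⟩
    rwa [Set.union_insert, Set.insert_eq_of_mem (Set.mem_union_left _ hu), Set.union_singleton]
      at this)
  root_clear := by
    rw [run_slide_clear hl hm]
    exact Or.inr h.root_clear

theorem slides_cons_cons_append {a b : V} {l : List V} (S : List (Move V)) :
    S ++ slides (a :: b :: l) = (S ++ [Move.slide a b]) ++ slides (b :: l) := by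
  rw [slides, List.append_assoc, List.singleton_append]

/-- What the moves of a single searcher do, if they are legal and cause no recontamination. -/
theorem IsPartial.append_slides [Fintype V] (h : IsPartial G x S) {a : V} {l : List V}
    (hs : IsSchedule G (S ++ slides (a :: l))) (hm : IsMonotone G (S ++ slides (a :: l))) :
    IsPartial G x (S ++ slides (a :: l)) ∧
      (run G (S ++ slides (a :: l))).clear = (run G S).clear ∪ {w | w ∈ l} ∧
      snMax G (S ++ slides (a :: l)) = snMax G S := by
  induction l generalizing a S with
  | nil => simp [slides, h]
  | cons b l ih =>
    rw [slides_cons_cons_append] at hs hm ⊢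
    obtain ⟨-, hl⟩ := isSchedule_append_singleton.1 hs.of_append
    obtain ⟨-, hm1⟩ := isMonotone_append_singleton.1 (isMonotone_append.1 hm).1
    obtain ⟨h1, h2, h3⟩ := ih (h.slide hl hm1) hs hm
    refine ⟨h1, ?_, ?_⟩
    · rw [h2, run_slide_clear hl hm1]
      ext w
      simp only [Set.mem_union, Set.mem_insert_iff, Set.mem_ofPred_eq, List.mem_cons]
      tauto
    · rw [h3, snMax_append_singleton, run_append_singleton]
      refine max_eq_left ?_
      have : ∑ v, (step G (run G S) (.slide a b)).searchers v = ∑ v, (run G S).searchers v :=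
        sum_moveSearchers_slide _ hl.1 hl.2.ne
      rw [this]
      exact sum_searchers_le_snMax

theorem IsPartial.traverse [Fintype V] (h : IsPartial G x S) {u v : V} {p : List V}
    (hp : Traversal G S u v p) :
    IsPartial G x (S ++ slides (p ++ [v])) ∧
      (run G (S ++ slides (p ++ [v]))).clear = insert v (run G S).clear ∧
      snMax G (S ++ slides (p ++ [v])) = snMax G S := by
  have hm := isMonotone_append.2 ⟨h.monotone, hp.noRecontamination⟩
  have hs := hp.schedule
  obtain ⟨a, l, rfl⟩ : ∃ a l, p = a :: l := by
    cases p with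
    | nil => exact absurd hp.ends (by simp)
    | cons a l => exact ⟨a, l, rfl⟩
  rw [List.cons_append] at hm hs ⊢
  obtain ⟨h1, h2, h3⟩ := h.append_slides hs hm
  refine ⟨h1, ?_, h3⟩
  rw [h2]
  ext w
  have := hp.inside w
  simp only [Set.mem_union, Set.mem_ofPred_eq, List.mem_append, Set.mem_insert_iff, List.mem_cons] at this ⊢
  tauto

/-- A searcher that is not needed where it stands can walk through the connected clear graph to any
node `u` and traverse the edge `uv`. On its way it is a second searcher on all nodes that have to
be guarded. -/
theorem IsPartial.exists_traversal_of_spare (h : IsPartial G x S) {w u v : V}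
    (hw : 0 < (run G S).searchers w)
    (hspare : 2 ≤ (run G S).searchers w ∨ ∀ z ∈ (run G S).dirty, ¬ G.Adj w z)
    (hu : u ∈ (run G S).clear) (huv : G.Adj u v) : ∃ p, Traversal G S u v p := by
  have hwc : w ∈ (run G S).clear := mem_clear_of_searchers_ne_zero (guarded_run S) hw.ne'
  suffices key : ∀ C : Set V, ∀ a b : C, (G.induce C).Walk a b → ∀ S, IsPartial G x S →
      (run G S).clear = C → 0 < (run G S).searchers a →
      (2 ≤ (run G S).searchers a ∨ ∀ z ∈ (run G S).dirty, ¬ G.Adj a z) → G.Adj b v →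
      ∃ l, (a.1 :: l).getLast? = some b.1 ∧ (∀ y ∈ a.1 :: l, y ∈ C) ∧
        IsSchedule G (S ++ slides (a.1 :: l ++ [v])) ∧
        IsMonotone G (S ++ slides (a.1 :: l ++ [v])) by
    obtain ⟨q⟩ := h.induce_connected.preconnected ⟨w, hwc⟩ ⟨u, hu⟩
    obtain ⟨l, h1, h2, h3, h4⟩ := key _ _ _ q S h rfl hw hspare huv
    exact ⟨_, h1, h2, h3, (isMonotone_append.1 h4).2⟩
  intro C a b q
  induction q with
  | @nil a =>
    intro S hS hC ha hsp hav
    have hm : (run G S).clear ⊆ (step G (run G S) (.slide a.1 v)).clear :=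
      step_slide_subset (guarded_run S) hav.ne
        (hsp.imp_right fun hz z hzd haz => absurd haz (hz z hzd))
    have := hS.slide ⟨ha, hav⟩ hm
    exact ⟨[], rfl, by simp [a.2], by simpa [slides] using this.schedule,
      by simpa [slides] using this.monotone⟩
  | @cons a a' b haa' q ih =>
    intro S hS hC ha hsp hbv
    have haa' : G.Adj a.1 a'.1 := haa'
    -- Having moved to `a'`, the searcher is again not needed: either it is not alone there, or `a'`
    -- was empty, so that it has no dirty neighbour.
    have hm : (run G S).clear ⊆ (step G (run G S) (.slide a.1 a'.1)).clear :=
      step_slide_subset (guarded_run S) haa'.ne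
        (hsp.imp_right fun hz z hzd haz => absurd haz (hz z hzd))
    have hS' := hS.slide ⟨ha, haa'⟩ hm
    have hC' : (run G (S ++ [Move.slide a.1 a'.1])).clear = (run G S).clear := by
      rw [run_slide_clear ⟨ha, haa'⟩ hm, Set.insert_eq_of_mem (hC ▸ a'.2)]
    have hk : (run G (S ++ [Move.slide a.1 a'.1])).searchers a'.1 =
        (run G S).searchers a'.1 + 1 := by
      rw [run_append_singleton]
      simp [step, moveSearchers, haa'.ne']
    obtain ⟨l, h1, h2, h3, h4⟩ := ih _ hS' (hC'.trans hC) (by omega) (by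
      rcases Nat.eq_zero_or_pos ((run G S).searchers a'.1) with h0 | h0
      · refine Or.inr fun z hz haz => ?_
        have hz' : z ∈ (run G S).dirty := by
          have : z ∉ (run G S).clear := by
            rw [← hC']
            exact fun hz' => hz' hz
          exact not_not.1 this
        exact (guarded_run S).2 a'.1 (hC ▸ a'.2) z hz' haz h0
      · exact Or.inl (by omega)) hbv
    refine ⟨a'.1 :: l, by rw [List.getLast?_cons_cons, h1], ?_, ?_, ?_⟩
    · intro y hy
      rcases List.mem_cons.1 hy with rfl | hy
      · exact a.2
      · exact h2 y hy
    · rw [List.cons_append, List.cons_append, slides_cons_cons_append]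
      exact h3
    · rw [List.cons_append, List.cons_append, slides_cons_cons_append]
      exact h4

/-- A searcher just placed on the root is not needed there: if it is alone on it, then the root was
clear without a searcher, and so has no dirty neighbour. -/
theorem IsPartial.exists_traversal_place (h : IsPartial G x S) {u v : V}
    (hu : u ∈ (run G S).clear) (huv : G.Adj u v) :
    ∃ p, Traversal G (S ++ [Move.place x]) u v p := by
  have hk : (run G (S ++ [Move.place x])).searchers x = (run G S).searchers x + 1 := by
    rw [run_append_singleton]
    simp [step, moveSearchers]
  refine h.place.exists_traversal_of_spare (w := x) (by omega) ?_ (h.clear_place ▸ hu) huv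
  rcases Nat.eq_zero_or_pos ((run G S).searchers x) with h0 | h0
  · refine Or.inr fun z hz hxz => ?_
    have hz' : z ∈ (run G S).dirty := by
      have : z ∉ (run G S).clear := by
        rw [← h.clear_place]
        exact fun hz' => hz' hz
      exact not_not.1 this
    exact (guarded_run S).2 x h.root_clear z hz' hxz h0
  · exact Or.inl (by omega)

end Partial

/-- Placing a new searcher for every node to be cleared gives a rooted IMC clearing search. -/
theorem exists_isIMCClearing [Finite V] {G : SimpleGraph V} (hG : G.Connected) (x : V) :
    ∃ S, IsIMCClearing G x S := by
  cases nonempty_fintype V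
  suffices key : ∀ d S, IsPartial G x S → (run G S).dirty.ncard = d →
      ∃ S', IsIMCClearing G x S' from key _ _ (isPartial_place x) rfl
  intro d
  induction d with
  | zero =>
    intro S hS hd
    exact ⟨S, hS.isIMCClearing ((Set.ncard_eq_zero (Set.toFinite _)).1 hd)⟩
  | succ d ih =>
    intro S hS hd
    obtain ⟨y, hy⟩ : (run G S).dirty.Nonempty := by
      rw [← Set.ncard_pos (Set.toFinite _)]
      omega
    obtain ⟨q⟩ := hG.preconnected x y
    obtain ⟨e, -, he1, he2⟩ := q.exists_boundary_dart _ hS.root_clear (fun h => h hy)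
    obtain ⟨p, hp⟩ := hS.exists_traversal_place he1 e.adj
    obtain ⟨h1, h2, -⟩ := hS.place.traverse hp
    refine ih _ h1 ?_
    have : (run G (S ++ [Move.place x] ++ slides (p ++ [e.snd]))).dirty =
        (run G S).dirty \ {e.snd} := by
      have h3 := congrArg compl h2
      rw [hS.clear_place, Set.insert_eq, Set.compl_union] at h3
      simpa [Config.clear, Set.inter_comm, Set.sdiff_eq] using h3
    rw [this, Set.ncard_sdiff_singleton_of_mem (not_not.1 he2), hd]
    rfl

/-! ### The number of searchers that an extension of the clear set requires -/

theorem IsIMCClearing.ne_nil {G : SimpleGraph V} {x : V} {S : List (Move V)} (h : IsIMCClearing G x S) : S ≠ [] := by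
  rintro rfl
  have := h.clearing
  rw [IsNodeClearing] at this
  exact (this ▸ Set.mem_univ x : x ∈ (run G []).clear) (Set.mem_univ x)

theorem notMem_clear {c : Config V} {z : V} : z ∉ c.clear ↔ z ∈ c.dirty := not_not

section Cost

variable [Fintype V] {G : SimpleGraph V}

open Classical in
/-- The nodes of `C` that have a neighbour outside `C`. -/
def boundary (G : SimpleGraph V) (C : Set V) : Finset V :=
  Finset.univ.filter fun w => w ∈ C ∧ ∃ z, z ∉ C ∧ G.Adj w z

open Classical in
/-- The number of searchers required for clearing `v` from `u` when `C` is the set of clear nodes: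
one for each boundary node, and one more if `u` still has to be guarded afterwards. -/
def cost (G : SimpleGraph V) (C : Set V) (u v : V) : ℕ :=
  (boundary G C).card + if ∃ z, z ∉ C ∧ z ≠ v ∧ G.Adj u z then 1 else 0

theorem mem_boundary {C : Set V} {w : V} :
    w ∈ boundary G C ↔ w ∈ C ∧ ∃ z, z ∉ C ∧ G.Adj w z := by
  simp [boundary]

/-- Every slide without recontamination needs at least `cost` searchers. -/
theorem cost_le_sum_searchers {c : Config V} (hc : Guarded G c) {u v : V}
    (hl : Legal G c (.slide u v)) (hm : c.clear ⊆ (step G c (.slide u v)).clear) :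
    cost G c.clear u v ≤ ∑ w, c.searchers w := by
  classical
  have hu : u ∈ c.clear := mem_clear_of_searchers_ne_zero hc hl.1.ne'
  have h1 : ∀ w ∈ boundary G c.clear, 1 ≤ c.searchers w := by
    intro w hw
    obtain ⟨hw, z, hz, hwz⟩ := mem_boundary.1 hw
    exact Nat.one_le_iff_ne_zero.2 (hc.2 w hw z (notMem_clear.1 hz) hwz)
  have hB : (boundary G c.clear).card = ∑ w, if w ∈ boundary G c.clear then 1 else 0 := by
    simp
  rw [cost]
  split_ifs with h
  · obtain ⟨z, hz, hzv, huz⟩ := h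
    have h2 : 2 ≤ c.searchers u := by
      by_contra hlt
      have hu1 : c.searchers u = 1 := by
        have := hl.1
        omega
      exact hzv (eq_of_step_slide_subset hu1 hu hm hc (notMem_clear.1 hz) huz)
    have hone : ∑ w, (if w = u then 1 else 0) = 1 := by simp
    calc _ = ∑ w, ((if w ∈ boundary G c.clear then 1 else 0) + if w = u then 1 else 0) := by
          rw [Finset.sum_add_distrib, hone, hB]
      _ ≤ _ := ?_
    refine Finset.sum_le_sum fun w _ => ?_
    have := h1 w
    split_ifs with h3 h4 h4
    · subst h4
      exact h2
    · exact this h3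
    · subst h4
      omega
    · exact Nat.zero_le _
  · rw [hB, add_zero]
    refine Finset.sum_le_sum fun w _ => ?_
    split_ifs with h3
    · exact h1 w h3
    · exact Nat.zero_le _

/-- If no searcher can traverse `uv`, then there is exactly one searcher on every boundary node and
none elsewhere, so that fewer than `cost` searchers are present. -/
theorem IsPartial.sum_searchers_lt_cost {x : V} {S : List (Move V)} (h : IsPartial G x S) {u v : V}
    (hu : u ∈ (run G S).clear) (hv : v ∈ (run G S).dirty) (huv : G.Adj u v)
    (hno : ¬ ∃ p, Traversal G S u v p) :
    ∑ w, (run G S).searchers w + 1 ≤ cost G (run G S).clear u v := by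
  classical
  have hc := guarded_run (G := G) S
  have hku : 0 < (run G S).searchers u := Nat.pos_of_ne_zero (hc.2 u hu v hv huv)
  have hcond : ∃ z, z ∉ (run G S).clear ∧ z ≠ v ∧ G.Adj u z := by
    by_contra hcon
    have hm : (run G S).clear ⊆ (step G (run G S) (.slide u v)).clear :=
      step_slide_subset hc huv.ne (Or.inr fun z hz huz => by
        by_contra hzv
        exact hcon ⟨z, notMem_clear.2 hz, hzv, huz⟩)
    have hp := h.slide ⟨hku, huv⟩ hm
    exact hno ⟨[u], rfl, by simpa using hu, by simpa [slides] using hp.schedule,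
      (isMonotone_append (l := slides ([u] ++ [v]))).1 hp.monotone |>.2⟩
  rw [cost, if_pos hcond]
  refine Nat.add_le_add_right ?_ 1
  have hB : (boundary G (run G S).clear).card =
      ∑ w, if w ∈ boundary G (run G S).clear then 1 else 0 := by simp
  rw [hB]
  refine Finset.sum_le_sum fun w _ => ?_
  rcases Nat.eq_zero_or_pos ((run G S).searchers w) with hw | hw
  · omega
  · have hns : ¬ (2 ≤ (run G S).searchers w ∨ ∀ z ∈ (run G S).dirty, ¬ G.Adj w z) :=
      fun hs => hno (h.exists_traversal_of_spare hw hs hu huv)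
    rw [not_or] at hns
    obtain ⟨h1, h2⟩ := hns
    push Not at h2
    obtain ⟨z, hz, hwz⟩ := h2
    rw [if_pos (mem_boundary.2
      ⟨mem_clear_of_searchers_ne_zero hc hw.ne', z, notMem_clear.2 hz, hwz⟩)]
    omega

/-- The clear set `C` can be extended to all nodes, one edge of `T` after the other, at a cost of at
most `k`. -/
inductive Completable (G T : SimpleGraph V) (k : ℕ) : Set V → Prop
  | univ : Completable G T k Set.univ
  | step {C : Set V} (u v : V) (hu : u ∈ C) (hv : v ∉ C) (huv : T.Adj u v)
      (hk : cost G C u v ≤ k) (h : Completable G T k (insert v C)) : Completable G T k C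

theorem Completable.connected [Nonempty V] {T : SimpleGraph V} {k : ℕ} {C : Set V}
    (h : Completable G T k C) (hC : ∀ a ∈ C, ∀ b ∈ C, T.Reachable a b) : T.Connected := by
  induction h with
  | univ => exact ⟨fun a b => hC a (Set.mem_univ a) b (Set.mem_univ b)⟩
  | @step C u v hu hv huv hk h ih =>
    have key : ∀ a ∈ (insert v C : Set V), T.Reachable u a := by
      rintro a (rfl | ha)
      · exact huv.reachable
      · exact hC u hu a ha
    exact ih fun a ha b hb => (key a ha).symm.trans (key b hb)

/-- The edges along which a rooted monotone search clears new nodes form a tree, along which the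
clear set can be extended at a cost of at most the number of searchers. -/
theorem exists_forest_of_schedule {x : V} {k : ℕ} (S : List (Move V)) (hne : S ≠ [])
    (hs : IsSchedule G S) (hr : IsRooted x S) (hi : IsInternal S) (hm : IsMonotone G S)
    (hk : snMax G S ≤ k) :
    x ∈ (run G S).clear ∧ ∃ T ≤ G, T.IsAcyclic ∧ (∀ a b, T.Adj a b → a ∈ (run G S).clear) ∧
      -- The tree is still growing, so the conclusion is stated for all larger graphs.
      ∀ T', T ≤ T' → Completable G T' k (run G S).clear → Completable G T' k {x} := by
  induction S using List.reverseRecOn with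
  | nil => exact absurd rfl hne
  | append_singleton S m ih =>
    obtain ⟨hs', hl⟩ := isSchedule_append_singleton.1 hs
    obtain ⟨hm', hmono⟩ := isMonotone_append_singleton.1 hm
    have hr' : IsRooted x S := fun v hv => hr v (List.mem_append_left _ hv)
    have hi' : IsInternal S := fun v hv => hi v (List.mem_append_left _ hv)
    rw [snMax_append_singleton] at hk
    have hk' := (le_max_left _ _).trans hk
    by_cases hS : S = []
    · subst hS
      cases m with
      | place y =>
        obtain rfl : y = x := hr y (by simp)
        rw [List.nil_append, run_place]
        exact ⟨rfl, ⊥, bot_le, SimpleGraph.isAcyclic_bot, fun a b h => absurd h (by simp),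
          fun T' _ h => h⟩
      | remove u => exact absurd (List.mem_append_right _ (by simp)) (hi u)
      | slide u v => exact absurd hl.1 (lt_irrefl 0)
    · obtain ⟨hx, T, hT, hac, hin, hcomp⟩ := ih hS hs' hr' hi' hm' hk'
      cases m with
      | place y =>
        obtain rfl : y = x := hr y (by simp)
        rw [run_append_singleton, step_place_clear (guarded_run S), Set.insert_eq_of_mem hx]
        exact ⟨hx, T, hT, hac, hin, hcomp⟩
      | remove u => exact absurd (List.mem_append_right _ (by simp)) (hi u)
      | slide u v =>
        have hu : u ∈ (run G S).clear :=
          mem_clear_of_searchers_ne_zero (guarded_run S) hl.1.ne'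
        rw [run_slide_clear hl hmono]
        by_cases hv : v ∈ (run G S).clear
        · rw [Set.insert_eq_of_mem hv]
          exact ⟨hx, T, hT, hac, hin, hcomp⟩
        · refine ⟨Or.inr hx, T ⊔ SimpleGraph.edge u v,
            sup_le hT ((SimpleGraph.edge_le_iff _).2 (Or.inr hl.2)),
            hac.sup_edge_of_not_reachable ?_, ?_, ?_⟩
          · rintro ⟨p⟩
            cases p.reverse with
            | nil => exact hv hu
            | cons h _ => exact hv (hin _ _ h)
          · rintro a b (hab | hab)
            · exact Or.inr (hin a b hab)
            · rw [SimpleGraph.edge_adj] at hab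
              rcases hab.1 with ⟨rfl, -⟩ | ⟨rfl, -⟩
              · exact Or.inr hu
              · exact Or.inl rfl
          · intro T' hT' hC
            refine hcomp T' (le_sup_left.trans hT') (.step u v hu hv (hT' (Or.inr ?_)) ?_ hC)
            · exact (SimpleGraph.edge_adj ..).2 ⟨Or.inl ⟨rfl, rfl⟩, hl.2.ne⟩
            · exact (cost_le_sum_searchers (guarded_run S) hl hmono).trans
                (sum_searchers_le_snMax.trans hk')

/-- The first move of a schedule can only be a placement. -/
theorem IsSchedule.one_le_snMax {S : List (Move V)} (h : IsSchedule G S) (hne : S ≠ []) :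
    1 ≤ snMax G S := by
  cases S with
  | nil => exact absurd rfl hne
  | cons m S =>
    have hl : Legal G Config.initial m := h 0 m rfl
    cases m with
    | place y =>
      have h1 : sn G (Move.place y :: S) 1 = 1 := by
        have := sum_moveSearchers_place (fun _ : V => 0) y
        simpa [sn, configAt, run, step, Config.initial] using this
      exact h1 ▸ Finset.le_sup (f := sn G (Move.place y :: S)) (Finset.mem_range.2 (by simp))
    | remove u => exact absurd hl (lt_irrefl 0)
    | slide u v => exact absurd hl.1 (lt_irrefl 0)

theorem IsIMCClearing.exists_tree {x : V} {S : List (Move V)} (h : IsIMCClearing G x S) :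
    ∃ T ≤ G, T.IsTree ∧ Completable G T (snMax G S) {x} := by
  have : Nonempty V := ⟨x⟩
  obtain ⟨-, T, hT, hac, -, hcomp⟩ := exists_forest_of_schedule S h.ne_nil h.schedule h.rooted h.internal
    h.monotone le_rfl
  have hC := hcomp T le_rfl (by
    rw [h.clearing]
    exact .univ)
  refine ⟨T, hT, ⟨hC.connected ?_, hac⟩, hC⟩
  rintro a rfl b rfl
  exact SimpleGraph.Reachable.refl _

end Cost

/-! ### The while loop -/

section Loop

variable [Fintype V] {G T : SimpleGraph V} {rule : Rule} {keep : Bool} {mover : Mover V} {x : V}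

theorem mem_candidates {c : Config V} {e : V × V} :
    e ∈ candidates T c ↔ T.Adj e.1 e.2 ∧ e.1 ∈ c.clear ∧ e.2 ∈ c.dirty := by
  simp [candidates]

theorem IsPartial.candidates_nonempty (hT : T.Connected) {S : List (Move V)} (h : IsPartial G x S)
    (hd : (run G S).dirty ≠ ∅) : (candidates T (run G S)).Nonempty := by
  obtain ⟨y, hy⟩ := Set.nonempty_iff_ne_empty.2 hd
  obtain ⟨q⟩ := hT.preconnected x y
  obtain ⟨e, -, he1, he2⟩ := q.exists_boundary_dart _ h.root_clear (fun h => h hy)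
  exact ⟨(e.fst, e.snd), mem_candidates.2 ⟨e.adj, he1, notMem_clear.1 he2⟩⟩

/-- The rest of a pass of the while loop, after the edge `e` has been selected. -/
def traverseOrPlace (G : SimpleGraph V) (rule : Rule) (keep : Bool) (mover : Mover V)
    (T : SimpleGraph V) (u₀ : V) (n : ℕ) (S : List (Move V)) (e : V × V) :
    PMF (Option (List (Move V))) :=
  open Classical in
  if ∃ p, Traversal G S e.1 e.2 p then
    (mover T u₀ S e.1 e.2).bind fun p =>
      searchLoop G rule keep mover T u₀ n none (S ++ slides (p ++ [e.2]))
  else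
    searchLoop G rule keep mover T u₀ n (if keep then some e else none) (S ++ [Move.place u₀])

theorem searchLoop_of_dirty_eq_empty {S : List (Move V)} (hd : (run G S).dirty = ∅) (n : ℕ)
    (target : Option (V × V)) :
    searchLoop G rule keep mover T x n target S = PMF.pure (some S) := by
  cases n <;> rw [searchLoop, if_pos hd]

theorem searchLoop_succ {S : List (Move V)} (hd : (run G S).dirty ≠ ∅)
    (h : (candidates T (run G S)).Nonempty) (n : ℕ) (target : Option (V × V)) :
    searchLoop G rule keep mover T x (n + 1) target S =
      (match target with
        | some e => PMF.pure e
        | none => selectEdge rule T x _ h).bind (traverseOrPlace G rule keep mover T x n S) := by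
  rw [searchLoop, if_neg hd, dif_pos h]
  rfl

theorem mem_of_mem_support_selectEdge {s : Finset (V × V)} (hs : s.Nonempty) {e : V × V}
    (he : e ∈ (selectEdge rule T x s hs).support) : e ∈ s := by
  cases rule with
  | R => simpa [selectEdge] using he
  | LW =>
    rw [selectEdge, inverselyProportional, PMF.support_normalize, Function.mem_support] at he
    by_contra h
    exact he (by simp [h])

theorem exists_selectEdge_bound (rule : Rule) (T : SimpleGraph V) (x : V) :
    ∃ δ : ℝ≥0∞, δ ≠ 0 ∧ δ ≤ 1 ∧ ∀ (s : Finset (V × V)) (hs : s.Nonempty), ∀ e ∈ s,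
      δ ≤ selectEdge rule T x s hs e := by
  classical
  have : Nonempty V := ⟨x⟩
  cases rule with
  | R =>
    exact ⟨((Fintype.card (V × V) : ℝ≥0∞))⁻¹, ENNReal.inv_ne_zero.2 (ENNReal.natCast_ne_top _), inv_card_le_one,
      fun s hs e he => inv_card_le_uniformOfFinset hs he⟩
  | LW =>
    -- Every label is at most the sum `Λ` of all labels, and the weights `1/λ` are at most 1.
    set Λ : ℕ := ∑ y, (rLabel T x y : ℕ) with hΛ
    have hle : ∀ y, (rLabel T x y : ℕ) ≤ Λ := fun y =>
      Finset.single_le_sum (f := fun y => (rLabel T x y : ℕ)) (fun _ _ => Nat.zero_le _)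
        (Finset.mem_univ y)
    have hΛ1 : 1 ≤ Λ := le_trans (rLabel T x x).pos (hle x)
    refine ⟨((Λ : ℝ≥0∞))⁻¹ * ((Fintype.card (V × V) : ℝ≥0∞))⁻¹,
      mul_ne_zero (ENNReal.inv_ne_zero.2 (ENNReal.natCast_ne_top _))
        (ENNReal.inv_ne_zero.2 (ENNReal.natCast_ne_top _)),
      mul_le_one' (ENNReal.inv_le_one.2 (by exact_mod_cast hΛ1)) inv_card_le_one, ?_⟩
    intro s hs e he
    rw [selectEdge, inverselyProportional, PMF.normalize_apply,
      Set.indicator_of_mem (by simpa using he)]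
    refine mul_le_mul' (ENNReal.inv_le_inv.2 (by exact_mod_cast hle e.2))
      (ENNReal.inv_le_inv.2 ?_)
    rw [tsum_eq_sum (s := s) (fun a ha => by simp [ha])]
    calc _ ≤ ∑ _a ∈ s, (1 : ℝ≥0∞) := Finset.sum_le_sum fun a ha => by
          rw [Set.indicator_of_mem (by simpa using ha), ENNReal.inv_le_one]
          exact_mod_cast (rLabel T x a.2).pos
      _ ≤ _ := by
          rw [Finset.sum_const, nsmul_one]
          exact_mod_cast Finset.card_le_univ s

theorem ncard_dirty_of_clear_eq_insert {c c' : Config V} {v : V} (hv : v ∈ c.dirty)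
    (h : c'.clear = insert v c.clear) : c.dirty.ncard = c'.dirty.ncard + 1 := by
  have h' : c'.dirty = c.dirty \ {v} := by
    have h3 := congrArg compl h
    rw [Set.insert_eq, Set.compl_union] at h3
    simpa [Config.clear, Set.inter_comm, Set.sdiff_eq] using h3
  have := Set.ncard_sdiff_singleton_add_one hv (Set.toFinite _)
  rw [h', this]

/-- On a connected tree, the while loop ends after at most two passes for each dirty node, and its
outcome is a rooted IMC clearing search. -/
theorem searchLoop_support (hmover : IsMover G mover) (hT : T.Connected) (hTG : T ≤ G) {d : ℕ}
    {S : List (Move V)} (h : IsPartial G x S) (hd : (run G S).dirty.ncard = d) {n : ℕ}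
    (hn : 2 * d ≤ n) {o : Option (List (Move V))}
    (ho : o ∈ (searchLoop G rule keep mover T x n none S).support) :
    ∃ S', o = some S' ∧ IsIMCClearing G x S' := by
  classical
  induction d generalizing S n o with
  | zero =>
    have hd : (run G S).dirty = ∅ := (Set.ncard_eq_zero (Set.toFinite _)).1 hd
    rw [searchLoop_of_dirty_eq_empty hd, PMF.mem_support_pure_iff] at ho
    exact ⟨S, ho, h.isIMCClearing hd⟩
  | succ d ih =>
    have hne : (run G S).dirty ≠ ∅ := by
      intro h0
      rw [h0, Set.ncard_empty] at hd
      omega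
    obtain ⟨n, rfl⟩ : ∃ k, n = k + 2 := ⟨n - 2, by omega⟩
    have traverse : ∀ {S' : List (Move V)} {n'} {e : V × V}, IsPartial G x S' →
        (run G S').dirty = (run G S).dirty → 2 * d ≤ n' → e ∈ candidates T (run G S') →
        (∃ p, Traversal G S' e.1 e.2 p) →
        o ∈ (traverseOrPlace G rule keep mover T x n' S' e).support →
        ∃ S', o = some S' ∧ IsIMCClearing G x S' := by
      intro S' n' e hS' hd' hn' he hp ho
      rw [traverseOrPlace, if_pos hp, PMF.mem_support_bind_iff] at ho
      obtain ⟨p, hp', ho⟩ := ho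
      obtain ⟨h1, h2, -⟩ := hS'.traverse (hmover T x S' e.1 e.2 hp p hp')
      have := ncard_dirty_of_clear_eq_insert (mem_candidates.1 he).2.2 h2
      rw [hd', hd] at this
      exact ih h1 (by omega) hn' ho
    have hcand := h.candidates_nonempty hT hne
    rw [searchLoop_succ hne hcand, PMF.mem_support_bind_iff] at ho
    obtain ⟨e, he, ho⟩ := ho
    have he := mem_of_mem_support_selectEdge _ he
    by_cases hp : ∃ p, Traversal G S e.1 e.2 p
    · exact traverse h rfl (by omega) he hp ho
    · rw [traverseOrPlace, if_neg hp] at ho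
      have hne' : (run G (S ++ [Move.place x])).dirty ≠ ∅ := by rwa [h.dirty_place]
      have hcand' := h.place.candidates_nonempty hT hne'
      rw [searchLoop_succ hne' hcand', PMF.mem_support_bind_iff] at ho
      obtain ⟨e', he', ho⟩ := ho
      have he' : e' ∈ candidates T (run G (S ++ [Move.place x])) := by
        cases keep with
        | false => exact mem_of_mem_support_selectEdge _ he'
        | true =>
          obtain rfl : e' = e := by simpa using he'
          obtain ⟨ha, hb, hc⟩ := mem_candidates.1 he
          exact mem_candidates.2 ⟨ha, by rwa [h.clear_place], by rwa [h.dirty_place]⟩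
      obtain ⟨ha, hb, -⟩ := mem_candidates.1 he'
      rw [h.clear_place] at hb
      exact traverse h.place h.dirty_place (by omega) he'
        (h.exists_traversal_place hb (hTG ha)) ho

/-- The loop selects the edges of an optimal extension with probability at least `δ` each. A new
searcher is then placed only if the selected edge requires it, so that there are never more than
`k` searchers. -/
theorem Completable.searchLoop_prob (hmover : IsMover G mover) (hTG : T ≤ G) {δ : ℝ≥0∞}
    (hδ1 : δ ≤ 1) (hδ : ∀ (s : Finset (V × V)) (hs : s.Nonempty), ∀ e ∈ s,
      δ ≤ selectEdge rule T x s hs e) {k : ℕ} {C : Set V} (hC : Completable G T k C)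
    {S : List (Move V)} (h : IsPartial G x S) (hS : (run G S).clear = C) (hk : snMax G S ≤ k)
    {d n : ℕ} (hd : (run G S).dirty.ncard = d) (hn : 2 * d ≤ n) :
    δ ^ (2 * d) ≤ (searchLoop G rule keep mover T x n none S).toOuterMeasure
      {o | ∃ S', o = some S' ∧ IsIMCClearing G x S' ∧ snMax G S' ≤ k} := by
  classical
  induction hC generalizing S d n with
  | univ =>
    have hd : (run G S).dirty = ∅ := by
      rw [Config.clear] at hS
      simpa using hS
    rw [searchLoop_of_dirty_eq_empty hd, PMF.toOuterMeasure_pure_apply,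
      if_pos ⟨S, rfl, h.isIMCClearing hd, hk⟩]
    exact pow_le_one' hδ1 _
  | @step C u v hu hv huv hcost _ ih =>
    subst hS
    have hv' : v ∈ (run G S).dirty := notMem_clear.1 hv
    have hne : (run G S).dirty ≠ ∅ := Set.nonempty_iff_ne_empty.1 ⟨v, hv'⟩
    obtain ⟨d, rfl⟩ : ∃ k, d = k + 1 := ⟨d - 1, by
      have := (Set.ncard_pos (Set.toFinite _)).2 (Set.nonempty_iff_ne_empty.2 hne)
      omega⟩
    obtain ⟨n, rfl⟩ : ∃ k, n = k + 2 := ⟨n - 2, by omega⟩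
    have traverse : ∀ {S' : List (Move V)} {n'}, IsPartial G x S' →
        (run G S').clear = (run G S).clear → (run G S').dirty = (run G S).dirty →
        snMax G S' ≤ k → 2 * d ≤ n' → (∃ p, Traversal G S' u v p) →
        δ ^ (2 * d) ≤ (traverseOrPlace G rule keep mover T x n' S' (u, v)).toOuterMeasure
          {o | ∃ S', o = some S' ∧ IsIMCClearing G x S' ∧ snMax G S' ≤ k} := by
      intro S' n' hS' hc' hd' hk' hn' hp
      rw [traverseOrPlace, if_pos hp]
      refine le_toOuterMeasure_bind _ _ _ _ fun p hp' => ?_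
      obtain ⟨h1, h2, h3⟩ := hS'.traverse (hmover T x S' u v hp p hp')
      have := ncard_dirty_of_clear_eq_insert (hd' ▸ hv') h2
      rw [hd', hd] at this
      rw [hc'] at h2
      exact ih h1 h2 (h3 ▸ hk') (by omega) hn'
    have he : (u, v) ∈ candidates T (run G S) := mem_candidates.2 ⟨huv, hu, hv'⟩
    rw [searchLoop_succ hne ⟨_, he⟩]
    refine le_trans ?_ (apply_mul_le_toOuterMeasure_bind _ _ (u, v) _)
    have hpow : δ ^ (2 * (d + 1)) = δ * (δ * δ ^ (2 * d)) := by
      rw [mul_add, pow_add]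
      ring
    rw [hpow]
    refine mul_le_mul' (hδ _ _ _ he) ?_
    by_cases hp : ∃ p, Traversal G S u v p
    · exact (mul_le_of_le_one_left zero_le hδ1).trans
        (traverse h rfl rfl hk (by omega) hp)
    · have hne' : (run G (S ++ [Move.place x])).dirty ≠ ∅ := by rwa [h.dirty_place]
      have he' : (u, v) ∈ candidates T (run G (S ++ [Move.place x])) :=
        mem_candidates.2 ⟨huv, by rwa [h.clear_place], by rwa [h.dirty_place]⟩
      have hk' : snMax G (S ++ [Move.place x]) ≤ k := by
        rw [snMax_append_singleton, run_append_singleton]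
        refine max_le hk (le_trans (le_of_eq ?_)
          ((h.sum_searchers_lt_cost hu hv' (hTG huv) hp).trans hcost))
        exact sum_moveSearchers_place _ _
      rw [traverseOrPlace, if_neg hp, searchLoop_succ hne' ⟨_, he'⟩]
      refine le_trans ?_ (apply_mul_le_toOuterMeasure_bind _ _ (u, v) _)
      refine mul_le_mul' ?_ (traverse h.place h.clear_place h.dirty_place hk' (by omega)
        (h.exists_traversal_place hu (hTG huv)))
      cases keep with
      | false => exact hδ _ _ _ he'
      | true => simpa using hδ1

end Loop

/-! ### Iterations and their repetition -/

section Iteration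

variable [Fintype V] {G : SimpleGraph V}

theorem ncard_dirty_le (S : List (Move V)) : (run G S).dirty.ncard ≤ Fintype.card V := by
  rw [← Nat.card_eq_fintype_card]
  exact Set.ncard_le_card _

theorem IsMinimalRootedIMC.of_le {S S' : List (Move V)} (h : IsMinimalRootedIMC G S) {x : V}
    (hS' : IsIMCClearing G x S') (hle : snMax G S' ≤ snMax G S) : IsMinimalRootedIMC G S' :=
  ⟨⟨x, hS'⟩, ⟨x, S', hS', rfl⟩, fun _ hk => hle.trans (h.2.2 hk)⟩

variable [Nonempty V]

theorem iteration_support {rule : Rule} {keep : Bool} {r : V} {order : List V} {mover : Mover V}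
    (ho : ∀ v, v ∈ order) (hmover : IsMover G mover) {limit : ℕ}
    (hlimit : 2 * Fintype.card V ≤ limit) {S : List (Move V)}
    (hS : some S ∈ (iteration G rule keep r order mover limit).support) :
    ∃ x, IsIMCClearing G x S := by
  rw [iteration, some_mem_support_andThen] at hS
  obtain ⟨T, hT, hS⟩ := hS
  obtain ⟨hTG, hTc⟩ := wilson_support ho hT
  rw [PMF.mem_support_bind_iff] at hS
  obtain ⟨x, -, hS⟩ := hS
  obtain ⟨S', h1, h2⟩ := searchLoop_support hmover hTc hTG (isPartial_place x) rfl
    ((Nat.mul_le_mul_left 2 (ncard_dirty_le _)).trans hlimit) hS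
  obtain rfl : S = S' := by simpa using h1
  exact ⟨x, h2⟩

theorem iteration_none_le (hG : G.Connected) {rule : Rule} {keep : Bool} {r : V} {order : List V}
    {mover : Mover V} (ho : ∀ v, v ∈ order) (hmover : IsMover G mover) {limit : ℕ}
    (hlimit : 2 * Fintype.card V ≤ limit) :
    (iteration G rule keep r order mover limit).toOuterMeasure {none} ≤
      order.length * walkTail V limit := by
  refine (toOuterMeasure_andThen_le_add _ _ _ 0 fun T hT => ?_).trans
    ((add_zero _).trans_le (wilson_none_le hG r order limit))
  obtain ⟨hTG, hTc⟩ := wilson_support ho hT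
  refine toOuterMeasure_bind_le _ _ _ fun x _ => le_of_eq ?_
  rw [PMF.toOuterMeasure_apply_eq_zero_iff, Set.disjoint_singleton_right]
  intro hnone
  obtain ⟨S', h1, -⟩ := searchLoop_support hmover hTc hTG (isPartial_place x) rfl
    ((Nat.mul_le_mul_left 2 (ncard_dirty_le _)).trans hlimit) hnone
  simp at h1

theorem exists_isMinimalRootedIMC (hG : G.Connected) :
    ∃ x S, IsIMCClearing G x S ∧ IsMinimalRootedIMC G S := by
  have hne : {k : ℕ | ∃ x S', IsIMCClearing G x S' ∧ snMax G S' = k}.Nonempty := by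
    obtain ⟨x⟩ := ‹Nonempty V›
    obtain ⟨S, hS⟩ := exists_isIMCClearing hG x
    exact ⟨_, x, S, hS, rfl⟩
  obtain ⟨x, S, hS, hk⟩ := Nat.sInf_mem hne
  refine ⟨x, S, hS, ⟨x, hS⟩, ⟨x, S, hS, rfl⟩, fun k hk' => ?_⟩
  rw [hk]
  exact Nat.sInf_le hk'

/-- One iteration finds a minimal search with a probability bounded below in terms of `G` only:
it may generate the tree and the root of a minimal search and clear the nodes in the same order. -/
theorem exists_iteration_prob (hG : G.Connected) (rule : Rule) :
    ∃ p : ℝ≥0∞, p ≠ 0 ∧ p ≤ 1 ∧ ∀ (keep : Bool) (r : V) (order : List V) (mover : Mover V),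
      (∀ v, v ∈ order) → IsMover G mover → ∀ limit, 2 * Fintype.card V ≤ limit →
        p ≤ (iteration G rule keep r order mover limit).toOuterMeasure
          {o | ∃ S, o = some S ∧ IsMinimalRootedIMC G S} := by
  obtain ⟨x, S₀, hS₀, hmin⟩ := exists_isMinimalRootedIMC hG
  obtain ⟨T, hTG, hT, hcomp⟩ := hS₀.exists_tree
  obtain ⟨δ, hδ0, hδ1, hδ⟩ := exists_selectEdge_bound rule T x
  set q : ℝ≥0∞ := ((Fintype.card V : ℝ≥0∞))⁻¹ with hq
  have hq0 : q ≠ 0 := ENNReal.inv_ne_zero.2 (ENNReal.natCast_ne_top _)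
  refine ⟨(q ^ Fintype.card V) ^ Fintype.card V * (q * δ ^ (2 * Fintype.card V)),
    mul_ne_zero (pow_ne_zero _ (pow_ne_zero _ hq0)) (mul_ne_zero hq0 (pow_ne_zero _ hδ0)),
    mul_le_one' (pow_le_one' (pow_le_one' inv_card_le_one _) _)
      (mul_le_one' inv_card_le_one (pow_le_one' hδ1 _)), ?_⟩
  intro keep r order mover ho hmover limit hlimit
  refine le_trans (mul_le_mul_left (wilson_isTree_prob hT hTG r ho (by omega)) _)
    (mul_le_toOuterMeasure_andThen _ _ (fun T' => T' = T) _ _ ?_)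
  rintro T' - rfl
  refine le_trans ?_ (apply_mul_le_toOuterMeasure_bind _ _ x _)
  rw [PMF.uniformOfFintype_apply]
  refine mul_le_mul_right (le_trans ?_ (le_trans (hcomp.searchLoop_prob (keep := keep) hmover hTG
    hδ1 hδ (isPartial_place x) (run_place x) (le_trans (le_of_eq ?_) (hS₀.schedule.one_le_snMax hS₀.ne_nil)) rfl
    ((Nat.mul_le_mul_left 2 (ncard_dirty_le _)).trans hlimit)) ?_)) _
  · exact pow_le_pow_right_of_le_one' hδ1 (Nat.mul_le_mul_left 2 (ncard_dirty_le _))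
  · have h1 := snMax_append_singleton (G := G) (S := []) (m := Move.place x)
    have h2 : ∑ v, (run G [Move.place x]).searchers v = 1 := by
      have := sum_moveSearchers_place (fun _ : V => 0) x
      simpa [run, step, Config.initial] using this
    rw [List.nil_append, h2] at h1
    rw [h1]
    simp [snMax, sn, configAt, run, Config.initial]
  · refine PMF.toOuterMeasure_mono _ ?_
    rintro _ ⟨⟨S', rfl, h1, h2⟩, -⟩
    exact ⟨S', rfl, hmin.of_le h1 h2⟩

variable {rule : Rule} {keep : Bool} {r : V} {order : List V} {mover : Mover V} {limit : ℕ}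
  {ε p : ℝ≥0∞}

/-- A minimal search, once found, is kept. -/
theorem gsstLoop_fail_le_of_isMinimal
    (hsupp : ∀ S, some S ∈ (iteration G rule keep r order mover limit).support →
      ∃ x, IsIMCClearing G x S)
    (hε : (iteration G rule keep r order mover limit).toOuterMeasure {none} ≤ ε)
    {Smin : List (Move V)} (hmin : IsMinimalRootedIMC G Smin) (m : ℕ) :
    (gsstLoop G rule keep r order mover limit m Smin (snMax G Smin)).toOuterMeasure
      {o | ∃ S, o = some S ∧ IsMinimalRootedIMC G S}ᶜ ≤ m * ε := by
  induction m with
  | zero =>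
    rw [gsstLoop, PMF.toOuterMeasure_pure_apply, if_neg (by simpa using hmin)]
    simp
  | succ m ih =>
    rw [gsstLoop, Nat.cast_succ, add_mul, one_mul, add_comm]
    refine (toOuterMeasure_andThen_le_add _ _ _ (m * ε) fun S hS => ?_).trans
      (add_le_add_left hε _)
    obtain ⟨x, hx⟩ := hsupp S hS
    have hle : snMax G Smin ≤ snMax G S := hmin.2.2 ⟨x, S, hx, rfl⟩
    rw [if_neg (by simpa using hle)]
    exact ih

theorem gsstLoop_fail_le
    (hsupp : ∀ S, some S ∈ (iteration G rule keep r order mover limit).support →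
      ∃ x, IsIMCClearing G x S)
    (hε : (iteration G rule keep r order mover limit).toOuterMeasure {none} ≤ ε)
    (hp : p ≤ (iteration G rule keep r order mover limit).toOuterMeasure
      {o | ∃ S, o = some S ∧ IsMinimalRootedIMC G S})
    (Smin : List (Move V)) {smin : ℕ∞}
    (hsmin : ∀ S, IsMinimalRootedIMC G S → (snMax G S : ℕ∞) < smin) (m : ℕ) :
    (gsstLoop G rule keep r order mover limit m Smin smin).toOuterMeasure
      {o | ∃ S, o = some S ∧ IsMinimalRootedIMC G S}ᶜ ≤ m * ε + (1 - p) ^ m := by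
  induction m generalizing Smin smin with
  | zero => exact (toOuterMeasure_le_one _ _).trans (by simp)
  | succ m ih =>
    rw [gsstLoop]
    refine (toOuterMeasure_andThen_le _ _ (IsMinimalRootedIMC G) _ (m * ε) ((1 - p) ^ m)
      (fun S hS hmin => ?_) fun S hS => ?_).trans ?_
    · rw [if_pos (hsmin S hmin)]
      exact gsstLoop_fail_le_of_isMinimal hsupp hε hmin m
    · obtain ⟨x, hx⟩ := hsupp S hS
      split_ifs with hlt
      · by_cases hmin : IsMinimalRootedIMC G S
        · exact (gsstLoop_fail_le_of_isMinimal hsupp hε hmin m).trans le_self_add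
        · refine ih S fun S' hS' => ?_
          rw [Nat.cast_lt]
          by_contra hle
          exact hmin (hS'.of_le hx (not_lt.1 hle))
      · exact ih Smin hsmin
    · have hfail : (iteration G rule keep r order mover limit).toOuterMeasure
          {o | ∃ S, o = some S ∧ IsMinimalRootedIMC G S}ᶜ ≤ 1 - p := by
        refine le_trans (ENNReal.le_sub_of_add_le_left ?_ (toOuterMeasure_add_compl _ _).le)
          (tsub_le_tsub_left hp 1)
        exact ne_top_of_le_ne_top ENNReal.one_ne_top (toOuterMeasure_le_one _ _)
      calc _ ≤ ε + (m * ε + (1 - p) * (1 - p) ^ m) :=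
            add_le_add hε (add_le_add_right (mul_le_mul_left hfail _) _)
        _ = _ := by
            rw [Nat.cast_succ, pow_succ']
            ring

/-- The failure probability after `M` iterations is at most `(1 - p)ᴹ` in the limit of large time
limits, where the probability of not ending vanishes. -/
theorem one_le_successProb_add (hG : G.Connected) (ho : ∀ v, v ∈ order)
    (hmover : IsMover G mover) (hp : ∀ limit, 2 * Fintype.card V ≤ limit →
      p ≤ (iteration G rule keep r order mover limit).toOuterMeasure
        {o | ∃ S, o = some S ∧ IsMinimalRootedIMC G S}) (M : ℕ) :
    1 ≤ successProb G rule keep r order mover M + (1 - p) ^ M := by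
  have hlim : Filter.Tendsto (fun limit : ℕ => successProb G rule keep r order mover M +
      (M * (order.length * walkTail V limit) + (1 - p) ^ M)) Filter.atTop
      (nhds (successProb G rule keep r order mover M + (M * (order.length * 0) + (1 - p) ^ M))) :=
    (((ENNReal.Tendsto.const_mul (ENNReal.Tendsto.const_mul tendsto_walkTail
      (Or.inr (ENNReal.natCast_ne_top _))) (Or.inr (ENNReal.natCast_ne_top _))).add_const
        _).const_add _)
  rw [mul_zero, mul_zero, zero_add] at hlim
  refine ge_of_tendsto hlim ?_
  filter_upwards [Filter.eventually_ge_atTop (2 * Fintype.card V)] with limit hlimit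
  refine (toOuterMeasure_add_compl (gsst G rule keep r order mover M limit)
    {o | ∃ S, o = some S ∧ IsMinimalRootedIMC G S}).ge.trans ?_
  exact add_le_add (le_iSup (fun limit => (gsst G rule keep r order mover M limit).toOuterMeasure
      {o | ∃ S, o = some S ∧ IsMinimalRootedIMC G S}) limit)
    (gsstLoop_fail_le (fun S => iteration_support ho hmover hlimit)
      (iteration_none_le hG ho hmover hlimit) (hp limit hlimit) [] (fun S _ => ENat.natCast_lt_top _) M)

theorem exists_successProb_bound (hG : G.Connected) (rule : Rule) :
    ∃ α : ℝ, 0 < α ∧ α < 1 ∧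
      ∀ (keep : Bool) (r : V) (order : List V) (mover : Mover V),
        (∀ v, v ∈ order) → IsMover G mover → ∀ M : ℕ,
          ENNReal.ofReal (1 - α ^ M) ≤ successProb G rule keep r order mover M := by
  obtain ⟨p, hp0, hp1, hp⟩ := exists_iteration_prob hG rule
  have htop : p ≠ ∞ := ne_top_of_le_ne_top ENNReal.one_ne_top hp1
  have hpos : 0 < p.toReal := ENNReal.toReal_pos hp0 htop
  have hle : p.toReal ≤ 1 := ENNReal.toReal_le_of_le_ofReal zero_le_one (by simpa using hp1)
  -- Halving `p` keeps `α` positive if `p = 1`.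
  refine ⟨1 - p.toReal / 2, by linarith, by linarith, ?_⟩
  intro keep r order mover ho hmover M
  have hα : 0 ≤ 1 - p.toReal / 2 := by linarith
  rw [ENNReal.ofReal_sub _ (pow_nonneg hα M), ENNReal.ofReal_one, ENNReal.ofReal_pow hα,
    tsub_le_iff_right]
  refine (one_le_successProb_add hG ho hmover (fun limit hl => hp keep r order mover ho hmover limit
    hl) M).trans (add_le_add_right (pow_le_pow_left' ?_ M) _)
  have h1 : 1 - p = ENNReal.ofReal (1 - p.toReal) := by
    rw [ENNReal.ofReal_sub _ hpos.le, ENNReal.ofReal_one, ENNReal.ofReal_toReal htop]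
  rw [h1]
  exact ENNReal.ofReal_le_ofReal (by linarith)

end Iteration

end GSST

end

theorem mainTheorem4 {V : Type*} [Fintype V] [Nonempty V] (G : SimpleGraph V)
    (hG : G.Connected) :
    (∃ α₁ : ℝ, 0 < α₁ ∧ α₁ < 1 ∧
      ∀ (keep : Bool) (r : V) (order : List V) (mover : GSST.Mover V),
        (∀ v, v ∈ order) → GSST.IsMover G mover → ∀ M : ℕ,
          ENNReal.ofReal (1 - α₁ ^ M) ≤
            GSST.successProb G GSST.Rule.R keep r order mover M) ∧
    (∃ α₂ : ℝ, 0 < α₂ ∧ α₂ < 1 ∧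
      ∀ (keep : Bool) (r : V) (order : List V) (mover : GSST.Mover V),
        (∀ v, v ∈ order) → GSST.IsMover G mover → ∀ M : ℕ,
          ENNReal.ofReal (1 - α₂ ^ M) ≤
            GSST.successProb G GSST.Rule.LW keep r order mover M) := by
  exact ⟨GSST.exists_successProb_bound hG .R, GSST.exists_successProb_bound hG .LW⟩
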